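/- Let $S^3=\{(x,y,z,w)\in\mathbb R^4 : x^2+y^2+z^2+w^2=1\}$ be the unit 3-sphere with its round metric, volume element $dV$ and Laplacian $\nabla^2=\operatorname{div}\operatorname{grad}$, and let toroidal coordinates $0\le\chi\le\pi/2$, $\theta,\varphi\in\mathbb R$ (modulo $2\pi$) parametrize it by $$x=\cos\chi\cos\theta,\quad y=\cos\chi\sin\theta,\quad z=\sin\chi\cos\varphi,\quad w=\sin\chi\sin\varphi .$$ For integers $k\ge 0$, $\ell$, $m$ with $|\ell|+|m|\le k$ and $\ell+m\equiv k\pmod 2$ put $d=\tfrac12\bigl(k-(|\ell|+|m|)\bigr)$, $$P_d^{(|m|,|\ell|)}(u)=\frac1{2^d}\sum_{i=0}^d\binom{|m|+d}{i}\binom{|\ell|+d}{d-i}(u+1)^i(u-1)^{d-i},$$ let $\Theta_\ell(\theta)=\cos|\ell|\theta$ if $\ell\ge0$ and $\sin|\ell|\theta$ if $\ell<0$, let $\Phi_m(\varphi)=\cos|m|\varphi$ if $m\ge0$ and $\sin|m|\varphi$ if $m<0$, let $\hat n=1$ if $n=0$ and $\hat n=0$ if $n\neq0$, and define $$\Psi_{k\ell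 m}(\chi,\theta,\varphi)=\frac{\cos^{|\ell|}\chi\,\sin^{|m|}\chi\;P_d^{(|m|,|\ell|)}(\cos2\chi)\;\Theta_\ell(\theta)\,\Phi_m(\varphi)}{\sqrt{2^{\hat\ell+\hat m}}\;\pi\;\sqrt{\dfrac{(|\ell|+d)!\,(|m|+d)!}{2(k+1)\,d!\,(|\ell|+|m|+d)!}}}\,.$$ **Theorem 1.** Each $\Psi_{k\ell m}$ is a well-defined function on $S^3$. For every integer $k\ge0$, the functions $\Psi_{k\ell m}$, taken over all integers $\ell,m$ with $|\ell|+|m|\le k$ and $\ell+m\equiv k\pmod 2$, form a basis, orthonormal for $\langle f,g\rangle=\int_{S^3}fg\,dV$, of the eigenspace $\{f\in C^\infty(S^3,\mathbb R):\nabla^2f=-k(k+2)f\}$. Taken over all such $k,\ell,m$ together, they form an orthonormal basis (orthonormal, linearly independent and spanning by finite linear combinations) of the space spanned by all smooth real eigenfunctions of the Laplacian on $S^3$. -/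

import Mathlib

open scoped ContDiff Manifold

noncomputable section

namespace ToroidalModes

/-- Euclidean 4-space, with coordinates `x = p 0`, `y = p 1`, `z = p 2`, `w = p 3`. -/
abbrev R4 : Type := EuclideanSpace ℝ (Fin 4)

/-- The unit 3-sphere `x² + y² + z² + w² = 1`. -/
abbrev S3 : Type := Metric.sphere (0 : R4) 1

/-! ### The Laplacian of the round 3-sphere, as divergence of the gradient -/

/-- The extension of a map on `S3` to `ℝ⁴ ∖ {0}` that is constant along rays from the origin
(with the value `0` at the origin). Its derivative at a point `p` of the sphere vanishes on the
normal line `ℝ p` and is the intrinsic derivative on the tangent space. -/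
def radialExt {F : Type*} [Zero F] (f : S3 → F) (x : R4) : F :=
  open Classical in
  if h : x ≠ 0 then
    f ⟨‖x‖⁻¹ • x, by simp [norm_smul, inv_mul_cancel₀ (norm_ne_zero_iff.mpr h)]⟩
  else 0

/-- The Riemannian gradient of `f` on `S3`: a tangent vector field, with values in `ℝ⁴`. -/
def sphereGrad (f : S3 → ℝ) (p : S3) : R4 :=
  gradient (radialExt f) (p : R4)

/-- The Riemannian divergence of a tangent vector field `V` on `S3`: the trace of the derivative of
`V` (the normal direction contributes `0` to the trace, as `radialExt V` is constant along it). -/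
def sphereDiv (V : S3 → R4) (p : S3) : ℝ :=
  LinearMap.trace ℝ R4 (fderiv ℝ (radialExt V) (p : R4) : R4 →ₗ[ℝ] R4)

/-- The Laplacian (Laplace–Beltrami operator) of the unit sphere `S3`. -/
def sphereLaplacian (f : S3 → ℝ) (p : S3) : ℝ :=
  sphereDiv (sphereGrad f) p

/-- Smooth real functions on the 3-sphere. -/
def SmoothOnS3 (f : S3 → ℝ) : Prop :=
  ContMDiff (𝓡 3) 𝓘(ℝ, ℝ) ∞ f

/-! Facts needed to see that an eigenspace is a linear subspace. -/

instance : Fact (Module.finrank ℝ R4 = 3 + 1) := ⟨by simp⟩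

theorem contDiffAt_radialExt {f : S3 → ℝ} (hf : SmoothOnS3 f) {x : R4} (hx : x ≠ 0) :
    ContDiffAt ℝ ∞ (radialExt f) x := by
  let U : TopologicalSpace.Opens R4 := ⟨{0}ᶜ, isOpen_compl_singleton⟩
  have hU : ∀ y : U, (y : R4) ≠ 0 := fun y => y.2
  have h1 : ContMDiff 𝓘(ℝ, R4) 𝓘(ℝ, R4) ∞ (fun y : U => ‖(y : R4)‖⁻¹ • (y : R4)) := by
    intro y
    refine (contMDiffAt_subtype_iff (f := fun y : R4 => ‖y‖⁻¹ • y)).mpr ?_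
    refine ContDiffAt.contMDiffAt ?_
    exact ((contDiffAt_norm ℝ (hU y)).inv (norm_ne_zero_iff.mpr (hU y))).smul contDiffAt_id
  have h2 := h1.codRestrict_sphere (n := 3)
    (fun y => by simp [norm_smul, inv_mul_cancel₀ (norm_ne_zero_iff.mpr (hU y))])
  have h3 := hf.comp h2
  have h4 : ContMDiffAt 𝓘(ℝ, R4) 𝓘(ℝ, ℝ) ∞ (radialExt f) x := by
    refine (contMDiffAt_subtype_iff (U := U) (x := ⟨x, hx⟩)).mp ?_
    convert h3 ⟨x, hx⟩ using 1
    funext y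
    simp [radialExt, hU y]
    rfl
  exact h4.contDiffAt

theorem differentiableAt_radialExt_grad {f : S3 → ℝ} (hf : SmoothOnS3 f) {x : R4} (hx : x ≠ 0) :
    DifferentiableAt ℝ (radialExt (sphereGrad f)) x := by
  have hn : ‖x‖⁻¹ • x ≠ 0 := smul_ne_zero (inv_ne_zero (norm_ne_zero_iff.mpr hx)) hx
  have hG : DifferentiableAt ℝ (fun y : R4 => gradient (radialExt f) y) (‖x‖⁻¹ • x) := by
    have h := (contDiffAt_radialExt hf hn).fderiv_right (m := 1) (by norm_cast)
    exact ((InnerProductSpace.toDual ℝ R4).symm.toContinuousLinearEquiv.differentiableAt).comp _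
      (h.differentiableAt (by norm_num))
  have hr : DifferentiableAt ℝ (fun y : R4 => ‖y‖⁻¹ • y) x :=
    (((contDiffAt_norm ℝ (n := 1) hx).inv (norm_ne_zero_iff.mpr hx)).smul
      contDiffAt_id).differentiableAt (by norm_num)
  refine (DifferentiableAt.comp (f := fun y : R4 => ‖y‖⁻¹ • y) x hG hr).congr_of_eventuallyEq ?_
  filter_upwards [isOpen_ne.mem_nhds hx] with y hy
  have hy' : y ≠ 0 := hy
  simp [radialExt, hy', sphereGrad]

theorem ne_zero_S3 (p : S3) : (p : R4) ≠ 0 := ne_zero_of_mem_unit_sphere p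

theorem radialExt_add {F : Type*} [AddMonoid F] (f g : S3 → F) :
    radialExt (f + g) = radialExt f + radialExt g := by
  funext x
  by_cases h : x = 0 <;> simp [radialExt, h]

theorem radialExt_smul {F : Type*} [AddCommGroup F] [Module ℝ F] (c : ℝ) (f : S3 → F) :
    radialExt (c • f) = c • radialExt f := by
  funext x
  by_cases h : x = 0 <;> simp [radialExt, h]

theorem sphereLaplacian_add {f g : S3 → ℝ} (hf : SmoothOnS3 f) (hg : SmoothOnS3 g) (p : S3) :
    sphereLaplacian (f + g) p = sphereLaplacian f p + sphereLaplacian g p := by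
  have hgrad : sphereGrad (f + g) = sphereGrad f + sphereGrad g := by
    funext q
    have h1 := (contDiffAt_radialExt hf (ne_zero_S3 q)).differentiableAt (by simp)
    have h2 := (contDiffAt_radialExt hg (ne_zero_S3 q)).differentiableAt (by simp)
    simp [sphereGrad, gradient, radialExt_add, fderiv_add h1 h2]
  simp [sphereLaplacian, sphereDiv, hgrad, radialExt_add,
    fderiv_add (differentiableAt_radialExt_grad hf (ne_zero_S3 p))
      (differentiableAt_radialExt_grad hg (ne_zero_S3 p))]

theorem sphereLaplacian_smul {f : S3 → ℝ} (hf : SmoothOnS3 f) (c : ℝ) (p : S3) :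
    sphereLaplacian (c • f) p = c * sphereLaplacian f p := by
  have hgrad : sphereGrad (c • f) = c • sphereGrad f := by
    funext q
    have h1 := (contDiffAt_radialExt hf (ne_zero_S3 q)).differentiableAt (by simp)
    simp [sphereGrad, gradient, radialExt_smul, fderiv_const_smul h1]
  simp [sphereLaplacian, sphereDiv, hgrad, radialExt_smul,
    fderiv_const_smul (differentiableAt_radialExt_grad hf (ne_zero_S3 p))]

/-- The space of smooth functions `f` on the 3-sphere with `Δ f = μ f`. -/
def eigenspace (μ : ℝ) : Submodule ℝ (S3 → ℝ) where
  carrier := {f | SmoothOnS3 f ∧ ∀ p, sphereLaplacian f p = μ * f p}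
  add_mem' := by
    rintro f g ⟨hf, hf'⟩ ⟨hg, hg'⟩
    refine ⟨ContMDiff.add hf hg, fun p => ?_⟩
    rw [sphereLaplacian_add hf hg, hf', hg', Pi.add_apply, mul_add]
  zero_mem' := by
    have h0 : SmoothOnS3 (0 : S3 → ℝ) := contMDiff_const
    refine ⟨h0, fun p => ?_⟩
    have h := sphereLaplacian_smul h0 0 p
    simpa using h
  smul_mem' := by
    rintro c f ⟨hf, hf'⟩
    refine ⟨(contMDiff_const (c := c)).mul hf, fun p => ?_⟩
    rw [sphereLaplacian_smul hf, hf', Pi.smul_apply, smul_eq_mul]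
    ring

/-! ### The inner product of functions on the sphere -/

/-- `⟨f, g⟩ = ∫_{S³} f g dV`, for the surface measure of the unit sphere. -/
def sphereInner (f g : S3 → ℝ) : ℝ :=
  ∫ p : S3, f p * g p ∂((MeasureTheory.volume : MeasureTheory.Measure R4).toSphere)

/-- The family `v` is an orthonormal basis of the space `W` of functions on `S3`: it is orthonormal,
linearly independent, and its linear span is `W`. -/
def IsOrthonormalBasisOf {ι : Type*} (v : ι → S3 → ℝ) (W : Submodule ℝ (S3 → ℝ)) : Prop :=
  (∀ i, sphereInner (v i) (v i) = 1) ∧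
  (∀ i j, i ≠ j → sphereInner (v i) (v j) = 0) ∧
  LinearIndependent ℝ v ∧
  Submodule.span ℝ (Set.range v) = W

/-! ### Toroidal coordinates -/

/-- The parametrization of the 3-sphere by toroidal coordinates. -/
def torPoint (χ θ φ : ℝ) : S3 :=
  ⟨!₂[Real.cos χ * Real.cos θ, Real.cos χ * Real.sin θ,
      Real.sin χ * Real.cos φ, Real.sin χ * Real.sin φ], by
    simp only [mem_sphere_iff_norm, sub_zero, EuclideanSpace.norm_eq, Fin.sum_univ_four,
      Real.norm_eq_abs, sq_abs, Real.sqrt_eq_one]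
    simp
    linear_combination (Real.cos χ) ^ 2 * Real.sin_sq_add_cos_sq θ +
      (Real.sin χ) ^ 2 * Real.sin_sq_add_cos_sq φ + Real.sin_sq_add_cos_sq χ⟩

/-- The coordinate `χ ∈ [0, π/2]` of a point. -/
def coordChi (p : S3) : ℝ :=
  Real.arccos (Real.sqrt ((p : R4) 0 ^ 2 + (p : R4) 1 ^ 2))

/-- The coordinate `θ` of a point, taken in `(-π, π]`; it is `0` where `x = y = 0`. -/
def coordTheta (p : S3) : ℝ :=
  Complex.arg ⟨(p : R4) 0, (p : R4) 1⟩

/-- The coordinate `φ` of a point, taken in `(-π, π]`; it is `0` where `z = w = 0`. -/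
def coordPhi (p : S3) : ℝ :=
  Complex.arg ⟨(p : R4) 2, (p : R4) 3⟩

/-! ### The modes -/

/-- The Jacobi polynomial `P_d^{(a,b)}(u)` for natural numbers `a`, `b`, `d`. -/
def jacobiP (a b d : ℕ) (u : ℝ) : ℝ :=
  1 / 2 ^ d * ∑ i ∈ Finset.range (d + 1),
    ((a + d).choose i : ℝ) * ((b + d).choose (d - i) : ℝ) * (u + 1) ^ i * (u - 1) ^ (d - i)

/-- The circular harmonic: `cos |n|t` for `n ≥ 0`, `sin |n|t` for `n < 0`. -/
def circHarmonic (n : ℤ) (t : ℝ) : ℝ :=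
  if 0 ≤ n then Real.cos (n.natAbs * t) else Real.sin (n.natAbs * t)

/-- `d = (k - (|ℓ| + |m|)) / 2`, an exact division of a nonnegative number for the indices of
`ModeIndex k`. -/
def modeDeg (k : ℕ) (l m : ℤ) : ℕ :=
  (k - (l.natAbs + m.natAbs)) / 2

/-- The unnormalized mode in toroidal coordinates. -/
def modeTilde (k : ℕ) (l m : ℤ) (χ θ φ : ℝ) : ℝ :=
  Real.cos χ ^ l.natAbs * Real.sin χ ^ m.natAbs *
    jacobiP m.natAbs l.natAbs (modeDeg k l m) (Real.cos (2 * χ)) *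
    circHarmonic l θ * circHarmonic m φ

/-- `1` if `n = 0`, and `0` otherwise. -/
def hat (n : ℤ) : ℕ := if n = 0 then 1 else 0

/-- The normalization constant. -/
def modeNorm (k : ℕ) (l m : ℤ) : ℝ :=
  Real.sqrt (2 ^ (hat l + hat m)) * Real.pi *
    Real.sqrt
      (((l.natAbs + modeDeg k l m).factorial * (m.natAbs + modeDeg k l m).factorial : ℝ) /
        (2 * ((k : ℝ) + 1) * (modeDeg k l m).factorial *
          (l.natAbs + m.natAbs + modeDeg k l m).factorial))

/-- The normalized mode in toroidal coordinates. -/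
def modeCoord (k : ℕ) (l m : ℤ) (χ θ φ : ℝ) : ℝ :=
  modeTilde k l m χ θ φ / modeNorm k l m

/-- The normalized mode `Ψ_{kℓm}` as a function on the 3-sphere. -/
def mode (k : ℕ) (l m : ℤ) (p : S3) : ℝ :=
  modeCoord k l m (coordChi p) (coordTheta p) (coordPhi p)

/-- Pairs `(ℓ, m)` of integers with `|ℓ| + |m| ≤ k` and `ℓ + m ≡ k (mod 2)`. -/
abbrev ModeIndex (k : ℕ) : Type :=
  {q : ℤ × ℤ // |q.1| + |q.2| ≤ (k : ℤ) ∧ q.1 + q.2 ≡ (k : ℤ) [ZMOD 2]}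

end ToroidalModes

end

/-!
Write `N₁ = x² + y²`, `N₂ = z² + w²`, and let `h_ℓ`, `h_m` be the homogeneous harmonic polynomials
`Re (x + iy)^|ℓ|` or `Im (x + iy)^|ℓ|` and their analogues in `z, w`. On the sphere, `N₁ = cos² χ`
and `N₂ = sin² χ`, so expanding the Jacobi polynomial shows that a mode is the restriction of a
multiple of the polynomial `∑_{i + j = d} c_{ij} N₁^i N₂^j h_ℓ h_m`, homogeneous of degree `k`. The
recurrence satisfied by the coefficients `c_{ij}` makes it harmonic, and the restriction of a
harmonic homogeneous polynomial of degree `k` is an eigenfunction with eigenvalue `-k (k + 2)`.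

By the divergence theorem the Laplacian is symmetric, so that modes with different `k` are
orthogonal; for different `ℓ` or `m`, the integral over one of the circles vanishes. To compute the
norms, a Gaussian integral over `ℝ⁴` separates the two planes and reduces them to a finite
difference of a binomial coefficient.

Every polynomial restricts to a linear combination of modes, and polynomials are dense in the
continuous functions on the sphere. Hence an eigenfunction orthogonal to all modes vanishes.
Subtracting from an eigenfunction its projection on the finitely many modes of the same eigenvalue
leaves such a function.
-/

open MeasureTheory
open Finset.HasAntidiagonal (antidiagonal mem_antidiagonal)

noncomputable section

namespace ToroidalModes

section PolyLaplacian

open MvPolynomial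

variable {σ R : Type*} [Fintype σ] [CommRing R]

/-- The Laplacian `∑ᵢ ∂ᵢ²` on polynomials in finitely many variables. -/
def polyLaplacian : MvPolynomial σ R →ₗ[R] MvPolynomial σ R :=
  ∑ i, (pderiv i).toLinearMap ∘ₗ (pderiv i).toLinearMap

/-- The polynomial `∑ᵢ Xᵢ²`, the square of the Euclidean norm. -/
def normSqPoly : MvPolynomial σ R := ∑ i, X i ^ 2

theorem polyLaplacian_apply (f : MvPolynomial σ R) :
    polyLaplacian f = ∑ i, pderiv i (pderiv i f) := by
  simp [polyLaplacian]

theorem pderiv_normSqPoly (i : σ) :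
    pderiv i (normSqPoly : MvPolynomial σ R) = 2 * X i := by
  classical
  simp [normSqPoly, pderiv_X, Pi.single_apply, Derivation.leibniz_pow]

theorem isHomogeneous_normSqPoly : (normSqPoly : MvPolynomial σ R).IsHomogeneous 2 :=
  .sum _ _ _ fun i _ => (isHomogeneous_X R i).pow 2

theorem polyLaplacian_normSqPoly_mul {g : MvPolynomial σ R} {n : ℕ} (hg : g.IsHomogeneous n) :
    polyLaplacian (normSqPoly * g) =
      normSqPoly * polyLaplacian g + (2 * Fintype.card σ + 4 * n) • g := by
  have hsecond (i : σ) : pderiv i (pderiv i (normSqPoly * g)) =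
      normSqPoly * pderiv i (pderiv i g) + 2 * g + 4 * (X i * pderiv i g) := by
    have hpderiv_two : pderiv i (2 : MvPolynomial σ R) = 0 :=
      (pderiv i).map_natCast 2
    simp only [Derivation.leibniz, map_add, pderiv_normSqPoly, smul_eq_mul, pderiv_X_self,
      hpderiv_two]
    ring
  simp only [polyLaplacian_apply, hsecond, Finset.sum_add_distrib, ← Finset.mul_sum,
    hg.sum_X_mul_pderiv, Finset.sum_const, Finset.card_univ, nsmul_eq_mul]
  push_cast
  ring

theorem polyLaplacian_normSqPoly_pow_succ_mul {h : MvPolynomial σ R} {n : ℕ}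
    (hh : h.IsHomogeneous n) (hharm : polyLaplacian h = 0) (i : ℕ) :
    polyLaplacian (normSqPoly ^ (i + 1) * h) =
      (2 * (i + 1) * (Fintype.card σ + 2 * n + 2 * i)) • (normSqPoly ^ i * h) := by
  have hstep (j : ℕ) := polyLaplacian_normSqPoly_mul ((isHomogeneous_normSqPoly.pow j).mul hh)
  induction i with
  | zero =>
    have h0 := hstep 0
    simp only [pow_zero, one_mul, hharm] at h0
    simp only [zero_add, pow_one, pow_zero, one_mul, h0, nsmul_eq_mul]
    push_cast
    ring
  | succ i ih =>
    rw [pow_succ', mul_assoc, hstep (i + 1), ih]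
    simp only [nsmul_eq_mul, pow_succ normSqPoly i]
    push_cast
    ring

end PolyLaplacian

section PlaneHarmonics

open MvPolynomial

/-- The power `(x + iy)ⁿ`, whose real and imaginary parts are polynomials in `x` and `y`; the
quadratic algebra with parameters `-1` and `0` adjoins a root `i` of `i² = -1`. -/
def complexPow (n : ℕ) : QuadraticAlgebra (MvPolynomial (Fin 2) ℝ) (-1) 0 :=
  ⟨X 0, X 1⟩ ^ n

/-- The harmonic polynomial of degree `|l|` in the plane that restricts to `circHarmonic l` on the
unit circle. -/
def harmPoly (l : ℤ) : MvPolynomial (Fin 2) ℝ :=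
  if 0 ≤ l then (complexPow l.natAbs).re else (complexPow l.natAbs).im

theorem re_complexPow_zero : (complexPow 0).re = 1 := rfl

theorem im_complexPow_zero : (complexPow 0).im = 0 := rfl

theorem re_complexPow_succ (n : ℕ) :
    (complexPow (n + 1)).re = X 0 * (complexPow n).re - X 1 * (complexPow n).im := by
  simp only [complexPow, pow_succ', QuadraticAlgebra.re_mul]
  ring

theorem im_complexPow_succ (n : ℕ) :
    (complexPow (n + 1)).im = X 0 * (complexPow n).im + X 1 * (complexPow n).re := by
  simp [complexPow, pow_succ', QuadraticAlgebra.im_mul]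

theorem isHomogeneous_complexPow (n : ℕ) :
    (complexPow n).re.IsHomogeneous n ∧ (complexPow n).im.IsHomogeneous n := by
  induction n with
  | zero =>
    rw [re_complexPow_zero, im_complexPow_zero]
    exact ⟨isHomogeneous_one _ _, isHomogeneous_zero _ _ _⟩
  | succ n ih =>
    have hX (j : Fin 2) {f : MvPolynomial (Fin 2) ℝ} (hf : f.IsHomogeneous n) :
        (X j * f).IsHomogeneous (n + 1) := add_comm n 1 ▸ (isHomogeneous_X ℝ j).mul hf
    rw [re_complexPow_succ, im_complexPow_succ]
    exact ⟨(hX 0 ih.1).sub (hX 1 ih.2), (hX 0 ih.2).add (hX 1 ih.1)⟩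

theorem isHomogeneous_harmPoly (l : ℤ) : (harmPoly l).IsHomogeneous l.natAbs := by
  unfold harmPoly
  split_ifs
  exacts [(isHomogeneous_complexPow _).1, (isHomogeneous_complexPow _).2]

theorem derivation_complexPow_succ
    (D : Derivation ℝ (MvPolynomial (Fin 2) ℝ) (MvPolynomial (Fin 2) ℝ)) (n : ℕ) :
    D (complexPow (n + 1)).re =
        (n + 1) * ((complexPow n).re * D (X 0) - (complexPow n).im * D (X 1)) ∧
      D (complexPow (n + 1)).im =
        (n + 1) * ((complexPow n).im * D (X 0) + (complexPow n).re * D (X 1)) := by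
  induction n with
  | zero =>
    simp [re_complexPow_succ, im_complexPow_succ, re_complexPow_zero, im_complexPow_zero]
  | succ n ih =>
    rw [re_complexPow_succ (n + 1), im_complexPow_succ (n + 1)]
    simp only [map_sub, map_add, Derivation.leibniz, smul_eq_mul, ih.1, ih.2]
    rw [re_complexPow_succ, im_complexPow_succ]
    push_cast
    constructor <;> ring

theorem polyLaplacian_complexPow (n : ℕ) :
    polyLaplacian (complexPow n).re = 0 ∧ polyLaplacian (complexPow n).im = 0 := by
  have hcast (i : Fin 2) (n : ℕ) : pderiv i (n : MvPolynomial (Fin 2) ℝ) = 0 :=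
    (pderiv i).map_natCast n
  rcases n with _ | _ | n
  · simp [polyLaplacian_apply, re_complexPow_zero, im_complexPow_zero]
  · simp [polyLaplacian_apply, derivation_complexPow_succ, re_complexPow_zero, im_complexPow_zero,
      pderiv_X, Pi.single_apply]
  · simp [polyLaplacian_apply, derivation_complexPow_succ, Derivation.leibniz, hcast, pderiv_X,
      Pi.single_apply]

theorem polyLaplacian_harmPoly (l : ℤ) : polyLaplacian (harmPoly l) = 0 := by
  unfold harmPoly
  split_ifs
  exacts [(polyLaplacian_complexPow _).1, (polyLaplacian_complexPow _).2]

theorem eval_polar_complexPow (n : ℕ) (r t : ℝ) :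
    eval ![r * Real.cos t, r * Real.sin t] (complexPow n).re = r ^ n * Real.cos (n * t) ∧
      eval ![r * Real.cos t, r * Real.sin t] (complexPow n).im = r ^ n * Real.sin (n * t) := by
  induction n with
  | zero => simp [re_complexPow_zero, im_complexPow_zero]
  | succ n ih =>
    simp only [re_complexPow_succ, im_complexPow_succ, map_sub, map_add, map_mul, ih.1, ih.2,
      eval_X, Matrix.cons_val_zero, Matrix.cons_val_one, Nat.cast_succ, add_mul, one_mul,
      Real.cos_add, Real.sin_add]
    constructor <;> ring

theorem eval_polar_harmPoly (l : ℤ) (r t : ℝ) :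
    eval ![r * Real.cos t, r * Real.sin t] (harmPoly l) = r ^ l.natAbs * circHarmonic l t := by
  unfold harmPoly circHarmonic
  split_ifs
  exacts [(eval_polar_complexPow _ r t).1, (eval_polar_complexPow _ r t).2]

theorem normSqPoly_fin_two : (normSqPoly : MvPolynomial (Fin 2) ℝ) = X 0 ^ 2 + X 1 ^ 2 := by
  simp [normSqPoly]

theorem two_smul_X_zero_mul_complexPow_succ (n : ℕ) :
    (2 : ℝ) • (X 0 * (complexPow (n + 1)).re) =
        (complexPow (n + 2)).re + normSqPoly * (complexPow n).re ∧
      (2 : ℝ) • (X 0 * (complexPow (n + 1)).im) =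
        (complexPow (n + 2)).im + normSqPoly * (complexPow n).im := by
  simp only [re_complexPow_succ, im_complexPow_succ, normSqPoly_fin_two, two_smul]
  constructor <;> ring

theorem two_smul_X_one_mul_complexPow_succ (n : ℕ) :
    (2 : ℝ) • (X 1 * (complexPow (n + 1)).re) =
        (complexPow (n + 2)).im - normSqPoly * (complexPow n).im ∧
      (2 : ℝ) • (X 1 * (complexPow (n + 1)).im) =
        normSqPoly * (complexPow n).re - (complexPow (n + 2)).re := by
  simp only [re_complexPow_succ, im_complexPow_succ, normSqPoly_fin_two, two_smul]
  constructor <;> ring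

section Spanning

variable {S : Submodule ℝ (MvPolynomial (Fin 2) ℝ)}

theorem normSqPoly_pow_mul_complexPow_mem (hS : ∀ i l, normSqPoly ^ i * harmPoly l ∈ S)
    (i n : ℕ) :
    normSqPoly ^ i * (complexPow n).re ∈ S ∧ normSqPoly ^ i * (complexPow n).im ∈ S := by
  refine ⟨by simpa [harmPoly] using hS i n, ?_⟩
  cases n with
  | zero => simp [im_complexPow_zero]
  | succ n => simpa [harmPoly] using hS i (Int.negSucc n)

theorem X_mul_normSqPoly_pow_mul_complexPow_mem (hS : ∀ i l, normSqPoly ^ i * harmPoly l ∈ S)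
    (j : Fin 2) (i n : ℕ) :
    X j * (normSqPoly ^ i * (complexPow n).re) ∈ S ∧
      X j * (normSqPoly ^ i * (complexPow n).im) ∈ S := by
  have hmem := normSqPoly_pow_mul_complexPow_mem hS
  simp only [mul_left_comm (X j)]
  cases n with
  | zero =>
    have hone := hmem i 1
    simp only [re_complexPow_succ, im_complexPow_succ, re_complexPow_zero, im_complexPow_zero,
      mul_zero, sub_zero, zero_add, mul_one] at hone ⊢
    fin_cases j
    exacts [⟨hone.1, zero_mem _⟩, ⟨hone.2, zero_mem _⟩]
  | succ n =>
    obtain ⟨hre, him⟩ := hmem i (n + 2)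
    obtain ⟨hre', him'⟩ := hmem (i + 1) n
    rw [pow_succ, mul_assoc] at hre' him'
    have hhalf {f : MvPolynomial (Fin 2) ℝ} (hf : normSqPoly ^ i * ((2 : ℝ) • f) ∈ S) :
        normSqPoly ^ i * f ∈ S := by
      rwa [mul_smul_comm, S.smul_mem_iff two_ne_zero] at hf
    obtain ⟨h0re, h0im⟩ := two_smul_X_zero_mul_complexPow_succ n
    obtain ⟨h1re, h1im⟩ := two_smul_X_one_mul_complexPow_succ n
    match j with
    | 0 =>
      exact ⟨hhalf (by simpa only [h0re, mul_add] using add_mem hre hre'),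
        hhalf (by simpa only [h0im, mul_add] using add_mem him him')⟩
    | 1 =>
      exact ⟨hhalf (by simpa only [h1re, mul_sub] using sub_mem him him'),
        hhalf (by simpa only [h1im, mul_sub] using sub_mem hre' hre)⟩

end Spanning

theorem span_normSqPoly_pow_mul_harmPoly :
    Submodule.span ℝ (Set.range fun p : ℕ × ℤ => normSqPoly ^ p.1 * harmPoly p.2) = ⊤ := by
  set S := Submodule.span ℝ (Set.range fun p : ℕ × ℤ => normSqPoly ^ p.1 * harmPoly p.2)
  have hX (j : Fin 2) (f : MvPolynomial (Fin 2) ℝ) (hf : f ∈ S) : f * X j ∈ S := by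
    have hle : S ≤ S.comap (LinearMap.mulLeft ℝ (X j)) := by
      refine Submodule.span_le.mpr ?_
      rintro _ ⟨p, rfl⟩
      have h := X_mul_normSqPoly_pow_mul_complexPow_mem (S := S)
        (fun i l => Submodule.subset_span ⟨(i, l), rfl⟩) j p.1 p.2.natAbs
      simp only [harmPoly]
      split_ifs
      exacts [h.1, h.2]
    exact mul_comm f (X j) ▸ hle hf
  refine eq_top_iff.mpr fun f _ => ?_
  induction f using MvPolynomial.induction_on with
  | C a =>
    rw [← mul_one (C a), ← smul_eq_C_mul]
    exact S.smul_mem a (Submodule.subset_span ⟨(0, 0), by simp [harmPoly, re_complexPow_zero]⟩)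
  | add f g hf hg => exact add_mem (hf trivial) (hg trivial)
  | mul_X f j hf => exact hX j f (hf trivial)

end PlaneHarmonics

section FourVariables

open MvPolynomial

/-- The product of a polynomial in the coordinates `x, y` and a polynomial in the coordinates
`z, w`. -/
def planeMul : MvPolynomial (Fin 2) ℝ →ₗ[ℝ] MvPolynomial (Fin 2) ℝ →ₗ[ℝ] MvPolynomial (Fin 4) ℝ :=
  (LinearMap.mul ℝ _).compl₁₂ (rename ![0, 1]).toLinearMap (rename ![2, 3]).toLinearMap

theorem planeMul_apply (f g : MvPolynomial (Fin 2) ℝ) :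
    planeMul f g = rename ![0, 1] f * rename ![2, 3] g := rfl

theorem isHomogeneous_planeMul {f g : MvPolynomial (Fin 2) ℝ} {a b : ℕ} (hf : f.IsHomogeneous a)
    (hg : g.IsHomogeneous b) : (planeMul f g).IsHomogeneous (a + b) :=
  hf.rename_isHomogeneous.mul hg.rename_isHomogeneous

theorem pderiv_rename_of_notMem_range {σ τ R : Type*} [CommSemiring R] {e : σ → τ} {j : τ}
    (hj : j ∉ Set.range e) (f : MvPolynomial σ R) : pderiv j (rename e f) = 0 := by
  classical
  refine pderiv_eq_zero_of_notMem_vars fun h => hj ?_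
  obtain ⟨i, -, hi⟩ := Finset.mem_image.mp (vars_rename e f h)
  exact ⟨i, hi⟩

theorem polyLaplacian_planeMul (f g : MvPolynomial (Fin 2) ℝ) :
    polyLaplacian (planeMul f g) = planeMul (polyLaplacian f) g + planeMul f (polyLaplacian g) := by
  have hxy (i : Fin 2) (h : MvPolynomial (Fin 2) ℝ) :
      pderiv (![(0 : Fin 4), 1] i) (rename ![0, 1] h) = rename ![0, 1] (pderiv i h) :=
    pderiv_rename (by decide) i h
  have hzw (i : Fin 2) (h : MvPolynomial (Fin 2) ℝ) :
      pderiv (![(2 : Fin 4), 3] i) (rename ![2, 3] h) = rename ![2, 3] (pderiv i h) :=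
    pderiv_rename (by decide) i h
  have hxy' (i : Fin 2) (h : MvPolynomial (Fin 2) ℝ) :
      pderiv (![(2 : Fin 4), 3] i) (rename ![0, 1] h) = 0 :=
    pderiv_rename_of_notMem_range (by revert i; decide) h
  have hzw' (i : Fin 2) (h : MvPolynomial (Fin 2) ℝ) :
      pderiv (![(0 : Fin 4), 1] i) (rename ![2, 3] h) = 0 :=
    pderiv_rename_of_notMem_range (by revert i; decide) h
  simp only [Fin.forall_fin_two, Matrix.cons_val_zero, Matrix.cons_val_one] at hxy hzw hxy' hzw'
  simp only [planeMul_apply, polyLaplacian_apply, LinearMap.add_apply, Derivation.leibniz,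
    smul_eq_mul, map_add, map_zero, hxy, hzw, hxy', hzw', Fin.sum_univ_two, Fin.sum_univ_four,
    mul_zero, add_zero, zero_add]
  ring

theorem map₂_planeMul_top : Submodule.map₂ planeMul ⊤ ⊤ = ⊤ := by
  refine eq_top_iff.mpr fun f _ => ?_
  induction f using MvPolynomial.induction_on' with
  | monomial s c =>
    have h : monomial s c = planeMul (C c * X 0 ^ s 0 * X 1 ^ s 1) (X 0 ^ s 2 * X 1 ^ s 3) := by
      simp [planeMul_apply, monomial_eq, Finsupp.prod_fintype, Fin.prod_univ_four, mul_assoc]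
    exact h ▸ Submodule.apply_mem_map₂ _ trivial trivial
  | add f g hf hg => exact add_mem (hf trivial) (hg trivial)

/-- The coefficient of `sⁱ tʲ` in the homogeneous form of degree `i + j` that restricts to the
Jacobi polynomial `P^{(a,b)}(s - t)` on the line `s + t = 1`. -/
def jacobiCoeff (a b i j : ℕ) : ℝ :=
  (-1) ^ j * ((a + (i + j)).choose i * (b + (i + j)).choose j)

theorem jacobiCoeff_recurrence (a b i j : ℕ) :
    jacobiCoeff a b (i + 1) j * ((i + 1) * (i + 1 + b)) +
      jacobiCoeff a b i (j + 1) * ((j + 1) * (j + 1 + a)) = 0 := by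
  have hi : (a + (i + j + 1)).choose (i + 1) * (i + 1) =
      (a + (i + j + 1)).choose i * (j + 1 + a) := by
    rw [Nat.choose_succ_right_eq, show a + (i + j + 1) - i = j + 1 + a by lia]
  have hj : (b + (i + j + 1)).choose (j + 1) * (j + 1) =
      (b + (i + j + 1)).choose j * (i + 1 + b) := by
    rw [Nat.choose_succ_right_eq, show b + (i + j + 1) - j = i + 1 + b by lia]
  have hi' := congrArg (Nat.cast (R := ℝ)) hi
  have hj' := congrArg (Nat.cast (R := ℝ)) hj
  push_cast at hi' hj'
  simp only [jacobiCoeff, ← add_assoc, add_right_comm i 1 j] at hi' hj' ⊢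
  rw [pow_succ]
  linear_combination (-1) ^ j * (b + i + j + 1).choose j * (i + 1 + b) * hi' -
    (-1) ^ j * (a + i + j + 1).choose i * (j + 1 + a) * hj'

/-- The harmonic homogeneous polynomial of degree `|l| + |m| + 2 d` whose restriction to the sphere
is the unnormalized mode. -/
def modePoly (l m : ℤ) (d : ℕ) : MvPolynomial (Fin 4) ℝ :=
  ∑ p ∈ antidiagonal d, jacobiCoeff m.natAbs l.natAbs p.1 p.2 •
    planeMul (normSqPoly ^ p.1 * harmPoly l) (normSqPoly ^ p.2 * harmPoly m)

theorem isHomogeneous_modePoly (l m : ℤ) (d : ℕ) :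
    (modePoly l m d).IsHomogeneous (l.natAbs + m.natAbs + 2 * d) := by
  refine .sum _ _ _ fun p hp => ?_
  have hfactor (i : ℕ) (n : ℤ) := (isHomogeneous_normSqPoly.pow i).mul (isHomogeneous_harmPoly n)
  have h := isHomogeneous_planeMul (hfactor p.1 l) (hfactor p.2 m)
  rw [show 2 * p.1 + l.natAbs + (2 * p.2 + m.natAbs) = l.natAbs + m.natAbs + 2 * d by
    rw [← mem_antidiagonal.mp hp]; ring] at h
  exact Submodule.smul_mem (homogeneousSubmodule _ _ _) _ h

theorem polyLaplacian_modePoly (l m : ℤ) (d : ℕ) : polyLaplacian (modePoly l m d) = 0 := by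
  have hzero (n : ℤ) : polyLaplacian (normSqPoly ^ 0 * harmPoly n) = 0 := by
    rw [pow_zero, one_mul, polyLaplacian_harmPoly]
  have hsucc (n : ℤ) (i : ℕ) : polyLaplacian (normSqPoly ^ (i + 1) * harmPoly n) =
      (4 * ((i + 1) * (i + 1 + n.natAbs)) : ℝ) • (normSqPoly ^ i * harmPoly n) := by
    rw [polyLaplacian_normSqPoly_pow_succ_mul (isHomogeneous_harmPoly n) (polyLaplacian_harmPoly n),
      ← Nat.cast_smul_eq_nsmul ℝ]
    congr 1
    simp only [Fintype.card_fin]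
    push_cast
    ring
  simp only [modePoly, map_sum, map_smul, polyLaplacian_planeMul, smul_add, Finset.sum_add_distrib]
  cases d with
  | zero => simp [polyLaplacian_harmPoly]
  | succ d =>
    rw [Finset.Nat.sum_antidiagonal_succ, Finset.Nat.sum_antidiagonal_succ' (n := d)]
    simp only [hzero, hsucc, map_zero, LinearMap.zero_apply, smul_zero, zero_add]
    rw [← Finset.sum_add_distrib]
    refine Finset.sum_eq_zero fun p _ => ?_
    simp only [map_smul, LinearMap.smul_apply, smul_smul, ← add_smul]
    rw [mul_left_comm, mul_left_comm _ 4, ← mul_add, jacobiCoeff_recurrence, mul_zero, zero_smul]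

end FourVariables

section Derivatives

open MvPolynomial

variable {E : Type*} [NormedAddCommGroup E] [InnerProductSpace ℝ E]

theorem hasFDerivAt_norm_of_ne_zero {x : E} (hx : x ≠ 0) :
    HasFDerivAt (fun y : E => ‖y‖) (‖x‖⁻¹ • innerSL ℝ x) x := by
  have h := (hasStrictFDerivAt_norm_sq x).hasFDerivAt.sqrt (by simpa using hx)
  simp only [Real.sqrt_sq (norm_nonneg _)] at h
  refine h.congr_fderiv ?_
  ext v
  simp
  ring

theorem hasFDerivAt_inv_norm_smul {p : E} (hp : ‖p‖ = 1) :
    HasFDerivAt (fun x : E => ‖x‖⁻¹ • x)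
      (ContinuousLinearMap.id ℝ E - (innerSL ℝ p).smulRight p) p := by
  have hp0 : p ≠ 0 := norm_ne_zero_iff.mp (by simp [hp])
  have hinv := (hasDerivAt_inv (norm_ne_zero_iff.mpr hp0)).comp_hasFDerivAt p
    (hasFDerivAt_norm_of_ne_zero hp0)
  refine (hinv.smul (hasFDerivAt_id p)).congr_fderiv ?_
  ext v
  simp [hp, sub_eq_add_neg]

theorem hasFDerivAt_eval {ι : Type*} [Fintype ι] (H : MvPolynomial ι ℝ)
    (x : EuclideanSpace ℝ ι) :
    HasFDerivAt (fun y : EuclideanSpace ℝ ι => eval y.ofLp H)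
      (∑ i, eval x.ofLp (pderiv i H) • (EuclideanSpace.proj i : EuclideanSpace ℝ ι →L[ℝ] ℝ)) x := by
  classical
  induction H using MvPolynomial.induction_on with
  | C a => simpa using hasFDerivAt_const a x
  | add f g hf hg =>
    simp only [map_add, add_smul, Finset.sum_add_distrib]
    exact hf.add hg
  | mul_X f i hf =>
    have h := hf.mul (EuclideanSpace.proj i : EuclideanSpace ℝ ι →L[ℝ] ℝ).hasFDerivAt
    simp only [map_mul, eval_X]
    refine h.congr_fderiv ?_
    ext v
    simp [Derivation.leibniz, pderiv_X, Pi.single_apply, add_mul, Finset.sum_add_distrib,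
      Finset.mul_sum, apply_ite (eval x.ofLp), mul_assoc]

theorem contDiff_eval {ι : Type*} [Fintype ι] (H : MvPolynomial ι ℝ) :
    ContDiff ℝ ∞ (fun x : EuclideanSpace ℝ ι => eval x.ofLp H) := by
  induction H using MvPolynomial.induction_on with
  | C a => simpa using contDiff_const
  | add f g hf hg => simpa using hf.add hg
  | mul_X f i hf =>
    simp only [map_mul, eval_X]
    exact hf.mul (EuclideanSpace.proj i : EuclideanSpace ℝ ι →L[ℝ] ℝ).contDiff

end Derivatives

section Restriction

open MvPolynomial

theorem radialExt_of_ne_zero {F : Type*} [Zero F] (V : S3 → F) {x : R4} (hx : x ≠ 0) :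
    radialExt V x = V ⟨‖x‖⁻¹ • x, by
      simp [norm_smul, inv_mul_cancel₀ (norm_ne_zero_iff.mpr hx)]⟩ := by
  simp [radialExt, hx]

theorem hasFDerivAt_radialExt {F : Type*} [NormedAddCommGroup F] [NormedSpace ℝ F] {V : S3 → F}
    {W : R4 → F} (hVW : ∀ q : S3, V q = W q) {p : S3} {W' : R4 →L[ℝ] F}
    (hW : HasFDerivAt W W' (p : R4)) :
    HasFDerivAt (radialExt V)
      (W' ∘L (ContinuousLinearMap.id ℝ R4 - (innerSL ℝ (p : R4)).smulRight (p : R4))) (p : R4) := by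
  have hp : (p : R4) = (fun x : R4 => ‖x‖⁻¹ • x) (p : R4) := by simp
  rw [hp] at hW
  refine (HasFDerivAt.comp (f := fun x : R4 => ‖x‖⁻¹ • x) (p : R4) hW
    (hasFDerivAt_inv_norm_smul (norm_eq_of_mem_sphere p))).congr_of_eventuallyEq ?_
  filter_upwards [isOpen_ne.mem_nhds (ne_zero_S3 p)] with x hx
  rw [radialExt_of_ne_zero V hx, hVW]
  rfl

/-- The restriction of polynomials in the coordinates of `ℝ⁴` to the 3-sphere. -/
def restrict : MvPolynomial (Fin 4) ℝ →ₐ[ℝ] C(S3, ℝ) :=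
  aeval fun i => ⟨fun p => (p : R4) i, by fun_prop⟩

theorem restrict_apply (H : MvPolynomial (Fin 4) ℝ) (p : S3) :
    restrict H p = eval (p : R4).ofLp H := by
  induction H using MvPolynomial.induction_on with
  | C a => simp [restrict]
  | add f g hf hg => simp [hf, hg]
  | mul_X f i hf =>
    rw [map_mul, ContinuousMap.mul_apply, hf]
    simp [restrict]

theorem restrict_normSqPoly : restrict normSqPoly = 1 := by
  ext p
  simpa [restrict_apply, normSqPoly] using (EuclideanSpace.real_norm_sq_eq (p : R4)).symm

theorem smoothOnS3_restrict (H : MvPolynomial (Fin 4) ℝ) : SmoothOnS3 (restrict H) := by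
  have h := (contDiff_eval H).contMDiff.comp (contMDiff_coe_sphere (E := R4) (n := 3) (m := ∞))
  exact h.congr fun p => restrict_apply H p

theorem sphereGrad_restrict (H : MvPolynomial (Fin 4) ℝ) (p : S3) :
    sphereGrad (restrict H) p = WithLp.toLp 2 fun i =>
      restrict (pderiv i H - (∑ j, X j * pderiv j H) * X i) p := by
  refine HasGradientAt.gradient ?_
  rw [HasGradientAt]
  refine (hasFDerivAt_radialExt (restrict_apply H) (hasFDerivAt_eval H (p : R4))).congr_fderiv ?_
  ext v
  simp [restrict_apply, PiLp.inner_apply, Fin.sum_univ_four]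
  ring

theorem sphereDiv_restrict (W : Fin 4 → MvPolynomial (Fin 4) ℝ) (p : S3) :
    sphereDiv (fun q => WithLp.toLp 2 fun i => restrict (W i) q) p =
      restrict (∑ i, pderiv i (W i) - ∑ i, X i * ∑ j, X j * pderiv j (W i)) p := by
  have hW := (PiLp.continuousLinearEquiv 2 ℝ fun _ : Fin 4 => ℝ).symm.hasFDerivAt.comp _
    (hasFDerivAt_pi.mpr fun i => hasFDerivAt_eval (W i) (p : R4))
  have h := hasFDerivAt_radialExt (V := fun q : S3 => WithLp.toLp 2 fun i => restrict (W i) q)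
    (fun q => by simp [restrict_apply]) hW
  rw [sphereDiv, h.fderiv, LinearMap.trace_eq_sum_inner _ (EuclideanSpace.basisFun (Fin 4) ℝ)]
  simp [restrict_apply, PiLp.inner_apply, Fin.sum_univ_four]
  ring

theorem sphereLaplacian_restrict {H : MvPolynomial (Fin 4) ℝ} {k : ℕ} (hH : H.IsHomogeneous k)
    (hharm : polyLaplacian H = 0) (p : S3) :
    sphereLaplacian (restrict H) p = -(k * (k + 2)) * restrict H p := by
  have hEuler {G : MvPolynomial (Fin 4) ℝ} {n : ℕ} (hG : G.IsHomogeneous n) :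
      ∑ j, X j * pderiv j G = (n : ℝ) • G := by
    rw [hG.sum_X_mul_pderiv, Nat.cast_smul_eq_nsmul]
  have hgrad : sphereGrad (restrict H) = fun q => WithLp.toLp 2 fun i =>
      restrict (pderiv i H - (k : ℝ) • (H * X i)) q := by
    funext q
    simp only [sphereGrad_restrict, hEuler hH, smul_mul_assoc]
  have hdiv : ∑ i, pderiv i (pderiv i H - (k : ℝ) • (H * X i)) = -(k * (k + 4) : ℝ) • H := by
    have hprod (i : Fin 4) : pderiv i (H * X i) = X i * pderiv i H + H := by
      simp [Derivation.leibniz, add_comm]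
    simp only [map_sub, Derivation.map_smul, hprod, Finset.sum_sub_distrib, ← Finset.smul_sum,
      Finset.sum_add_distrib, hEuler hH, ← polyLaplacian_apply, hharm, Finset.sum_const,
      Finset.card_univ, Fintype.card_fin]
    module
  have hnormal : ∑ i, X i * ∑ j, X j * pderiv j (pderiv i H - (k : ℝ) • (H * X i)) =
      ((k - 1 : ℕ) * k : ℝ) • H - (k * (k + 1) : ℝ) • (normSqPoly * H) := by
    have hradial (i : Fin 4) : ∑ j, X j * pderiv j (pderiv i H - (k : ℝ) • (H * X i)) =
        ((k - 1 : ℕ) : ℝ) • pderiv i H - (k * (k + 1) : ℝ) • (H * X i) := by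
      simp only [map_sub, Derivation.map_smul, mul_sub, mul_smul_comm, Finset.sum_sub_distrib,
        ← Finset.smul_sum, hEuler hH.pderiv, hEuler (hH.mul (isHomogeneous_X ℝ i)), smul_smul,
        Nat.cast_add, Nat.cast_one]
    have hsum : ∑ i, X i * (H * X i) = normSqPoly * H := by
      rw [normSqPoly, Finset.sum_mul]
      exact Finset.sum_congr rfl fun i _ => by ring
    simp only [hradial, mul_sub, mul_smul_comm, Finset.sum_sub_distrib, ← Finset.smul_sum,
      hEuler hH, smul_smul, hsum]
  have hk : ((k - 1 : ℕ) * k : ℝ) = (k - 1) * k := by cases k <;> simp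
  rw [sphereLaplacian, hgrad, sphereDiv_restrict, hdiv, hnormal, hk]
  simp only [map_sub, map_smul, map_mul, restrict_normSqPoly, one_mul, ContinuousMap.sub_apply,
    ContinuousMap.smul_apply, smul_eq_mul]
  ring

end Restriction

section Divergence

variable {E : Type*} [NormedAddCommGroup E] [InnerProductSpace ℝ E] [FiniteDimensional ℝ E]

theorem trace_fderiv_smul {f : E → ℝ} {V : E → E} {x : E} (hf : DifferentiableAt ℝ f x)
    (hV : DifferentiableAt ℝ V x) :
    LinearMap.trace ℝ E (fderiv ℝ (fun y => f y • V y) x : E →ₗ[ℝ] E) =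
      f x * LinearMap.trace ℝ E (fderiv ℝ V x : E →ₗ[ℝ] E) + fderiv ℝ f x (V x) := by
  rw [fderiv_fun_smul hf hV, ContinuousLinearMap.toLinearMap_add, map_add,
    ContinuousLinearMap.toLinearMap_smul, map_smul, smul_eq_mul]
  congr 1
  exact LinearMap.trace_smulRight (fderiv ℝ f x : E →ₗ[ℝ] ℝ) (V x)

theorem trace_fderiv_radial_smul {ρ : ℝ → ℝ} (hρ : Differentiable ℝ ρ) {V : E → E} {x : E}
    (hx : x ≠ 0) (hV : DifferentiableAt ℝ V x) (htangent : inner ℝ x (V x) = 0) :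
    LinearMap.trace ℝ E (fderiv ℝ (fun y => ρ ‖y‖ • V y) x : E →ₗ[ℝ] E) =
      ρ ‖x‖ * LinearMap.trace ℝ E (fderiv ℝ V x : E →ₗ[ℝ] E) := by
  have hradial : HasFDerivAt (fun y => ρ ‖y‖) (deriv ρ ‖x‖ • ‖x‖⁻¹ • innerSL ℝ x) x :=
    (hρ ‖x‖).hasDerivAt.comp_hasFDerivAt x (hasFDerivAt_norm_of_ne_zero hx)
  rw [trace_fderiv_smul hradial.differentiableAt hV, hradial.fderiv]
  simp [htangent]

theorem integral_trace_fderiv_eq_zero [MeasurableSpace E] [BorelSpace E] (μ : Measure E)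
    [μ.IsAddHaarMeasure] {F : E → E} (hF : ContDiff ℝ 1 F) (hsupp : HasCompactSupport F) :
    ∫ x, LinearMap.trace ℝ E (fderiv ℝ F x : E →ₗ[ℝ] E) ∂μ = 0 := by
  set e := stdOrthonormalBasis ℝ E
  have hcoord (i) : ContDiff ℝ 1 fun x => inner ℝ (e i) (F x) := contDiff_const.inner ℝ hF
  have hcoordsupp (i) : HasCompactSupport fun x => inner ℝ (e i) (F x) :=
    hsupp.comp_left (g := fun v => inner ℝ (e i) v) (inner_zero_right _)
  have hint (i) : Integrable (fun x => fderiv ℝ (fun x => inner ℝ (e i) (F x)) x (e i)) μ :=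
    (((hcoord i).continuous_fderiv one_ne_zero).clm_apply
      continuous_const).integrable_of_hasCompactSupport ((hcoordsupp i).fderiv_apply ℝ _)
  have hzero (i) : ∫ x, fderiv ℝ (fun x => inner ℝ (e i) (F x)) x (e i) ∂μ = 0 := by
    simpa using integral_mul_fderiv_eq_neg_fderiv_mul_of_integrable (μ := μ) (v := e i)
      (f := fun _ => (1 : ℝ)) (by simp) (by simpa using hint i)
      (by simpa using (hcoord i).continuous.integrable_of_hasCompactSupport (hcoordsupp i))
      (fun _ _ => differentiableAt_const _)
      (fun x _ => (hcoord i).differentiable one_ne_zero x)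
  have htrace (x : E) : LinearMap.trace ℝ E (fderiv ℝ F x : E →ₗ[ℝ] E) =
      ∑ i, fderiv ℝ (fun x => inner ℝ (e i) (F x)) x (e i) := by
    rw [LinearMap.trace_eq_sum_inner _ e]
    refine Finset.sum_congr rfl fun i _ => ?_
    rw [fderiv_inner_apply ℝ (differentiableAt_const _) (hF.differentiable one_ne_zero x)]
    simp
  simp only [htrace]
  rw [integral_finsetSum _ fun i _ => hint i, Finset.sum_eq_zero fun i _ => hzero i]

end Divergence

section RadialCutoff

variable {E F : Type*} [NormedAddCommGroup E] [NormedAddCommGroup F] [NormedSpace ℝ F]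

theorem contDiff_radial_smul [InnerProductSpace ℝ E] {n : WithTop ℕ∞} {ρ : ℝ → ℝ}
    (hρ : ContDiff ℝ n ρ) (hzero : ∀ r ≤ 1, ρ r = 0) {V : E → F}
    (hV : ∀ x ≠ 0, ContDiffAt ℝ n V x) : ContDiff ℝ n fun x => ρ ‖x‖ • V x := by
  refine contDiff_iff_contDiffAt.mpr fun x => ?_
  by_cases hx : x = 0
  · refine (contDiffAt_const (c := (0 : F))).congr_of_eventuallyEq ?_
    filter_upwards [Metric.ball_mem_nhds x one_pos] with y hy
    rw [hzero _ (by simpa [hx] using (Metric.mem_ball.mp hy).le), zero_smul]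
  · exact (hρ.contDiffAt.comp x (contDiffAt_norm ℝ hx)).smul (hV x hx)

theorem hasCompactSupport_radial_smul [ProperSpace E] {ρ : ℝ → ℝ} {R : ℝ}
    (hzero : ∀ r, R ≤ r → ρ r = 0) (V : E → F) : HasCompactSupport fun x => ρ ‖x‖ • V x := by
  refine HasCompactSupport.intro (isCompact_closedBall (0 : E) R) fun x hx => ?_
  rw [hzero _ (by simpa using (lt_of_not_ge fun h => hx (by simpa using h)).le), zero_smul]

end RadialCutoff

section SphereDivergence

theorem radialExt_smul_pos {F : Type*} [Zero F] (V : S3 → F) {c : ℝ} (hc : 0 < c) (x : R4) :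
    radialExt V (c • x) = radialExt V x := by
  by_cases hx : x = 0
  · simp [hx]
  · rw [radialExt_of_ne_zero V hx, radialExt_of_ne_zero V (smul_ne_zero hc.ne' hx)]
    congr 2
    rw [norm_smul, smul_smul, Real.norm_of_nonneg hc.le]
    congr 1
    field_simp

theorem fderiv_radialExt_smul {F : Type*} [NormedAddCommGroup F] [NormedSpace ℝ F] (V : S3 → F)
    {c : ℝ} (hc : 0 < c) (x : R4) :
    fderiv ℝ (radialExt V) (c • x) = c⁻¹ • fderiv ℝ (radialExt V) x := by
  have h := fderiv_comp_smul (𝕜 := ℝ) (f := radialExt V) (x := x) c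
  simp only [radialExt_smul_pos V hc] at h
  rw [h, smul_smul, inv_mul_cancel₀ hc.ne', one_smul]

theorem norm_mul_trace_fderiv_radialExt (V : S3 → R4) {x : R4} (hx : x ≠ 0) :
    ‖x‖ * LinearMap.trace ℝ R4 (fderiv ℝ (radialExt V) x : R4 →ₗ[ℝ] R4) =
      radialExt (sphereDiv V) x := by
  have hn : 0 < ‖x‖⁻¹ := inv_pos.mpr (norm_pos_iff.mpr hx)
  rw [radialExt_of_ne_zero _ hx, sphereDiv, fderiv_radialExt_smul _ hn]
  simp

theorem integral_norm_mul_radialExt (a : ℝ → ℝ) (h : S3 → ℝ) :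
    ∫ x : R4, a ‖x‖ * radialExt h x =
      (∫ r : Set.Ioi (0 : ℝ), a r ∂(Measure.volumeIoiPow 3)) *
        ∫ p : S3, h p ∂((volume : Measure R4).toSphere) :=
  calc
    ∫ x : R4, a ‖x‖ * radialExt h x =
        ∫ x : ({0}ᶜ : Set R4), a ‖(x : R4)‖ * radialExt h x
          ∂(Measure.comap Subtype.val volume) := by
      rw [integral_subtype_comap (measurableSet_singleton _).compl
        fun x : R4 => a ‖x‖ * radialExt h x, restrict_compl_singleton]
    _ = ∫ y : S3 × Set.Ioi (0 : ℝ), h y.1 * a y.2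
          ∂((volume : Measure R4).toSphere.prod (.volumeIoiPow 3)) := by
      have hd : Module.finrank ℝ R4 - 1 = 3 := by simp
      rw [← hd, ← (volume : Measure R4).measurePreserving_homeomorphUnitSphereProd.integral_comp
        (Homeomorph.measurableEmbedding _) fun y => h y.1 * a y.2]
      refine integral_congr_ae (.of_forall fun x => ?_)
      have hx : (x : R4) ≠ 0 := x.2
      simp only [radialExt_of_ne_zero h hx, homeomorphUnitSphereProd_apply_snd_coe]
      rw [mul_comm]
      congr 2
      apply Subtype.ext
      simp
    _ = _ := by rw [integral_prod_mul h fun r : Set.Ioi (0 : ℝ) => a r, mul_comm]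

theorem integral_volumeIoiPow_ne_zero {a : ℝ → ℝ} (ha : Continuous a) (hnonneg : 0 ≤ a) {R : ℝ}
    (hzero : ∀ r, R ≤ r → a r = 0) {r₀ : ℝ} (hr₀ : 0 < r₀) (hne : a r₀ ≠ 0) :
    ∫ r : Set.Ioi (0 : ℝ), a r ∂(Measure.volumeIoiPow 3) ≠ 0 := by
  intro h
  have hpolar := integral_norm_mul_radialExt a fun _ => 1
  rw [h, zero_mul] at hpolar
  have hone : ∀ᵐ x : R4, a ‖x‖ * radialExt (fun _ => (1 : ℝ)) x = a ‖x‖ • (1 : ℝ) := by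
    filter_upwards [Measure.ae_ne volume 0] with x hx
    rw [radialExt_of_ne_zero _ hx, smul_eq_mul]
  rw [integral_congr_ae hone] at hpolar
  refine hpolar.not_gt (Continuous.integral_pos_of_hasCompactSupport_nonneg_nonzero
    (x := r₀ • EuclideanSpace.single 0 1) (by fun_prop)
    (hasCompactSupport_radial_smul hzero _) (fun x => by simpa using hnonneg ‖x‖) ?_)
  simpa [norm_smul, abs_of_pos hr₀] using hne

theorem exists_contDiff_radial_cutoff : ∃ b : ℝ → ℝ, ContDiff ℝ 1 b ∧ 0 ≤ b ∧
    (∀ r ≤ 1, b r = 0) ∧ (∀ r, 3 ≤ r → b r = 0) ∧ b 2 ≠ 0 := by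
  let b : ContDiffBump (2 : ℝ) := ⟨1 / 2, 1, by norm_num, by norm_num⟩
  have hb {r : ℝ} (hr : 1 ≤ |r - 2|) : b r = 0 :=
    b.zero_of_le_dist (by simpa [Real.dist_eq] using hr)
  refine ⟨b, b.contDiff, fun _ => b.nonneg, fun r hr => hb ?_, fun r hr => hb ?_, ?_⟩
  · rw [abs_of_nonpos] <;> linarith
  · rw [abs_of_nonneg] <;> linarith
  · simp [b.one_of_mem_closedBall (Metric.mem_closedBall_self b.rIn_pos.le)]

theorem inner_radialExt {V : S3 → R4} (htangent : ∀ p : S3, inner ℝ (p : R4) (V p) = 0) {x : R4}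
    (hx : x ≠ 0) : inner ℝ x (radialExt V x) = 0 := by
  have h := htangent ⟨‖x‖⁻¹ • x, by simp [norm_smul, hx]⟩
  rw [radialExt_of_ne_zero V hx]
  simpa [inner_smul_left, hx] using h

/-- Cut off radially, a tangent field extends to a compactly supported field on `ℝ⁴`; its
divergence integrates to zero and, in polar coordinates, is a multiple of the one on the sphere. -/
theorem integral_sphereDiv_eq_zero {V : S3 → R4} (htangent : ∀ p : S3, inner ℝ (p : R4) (V p) = 0)
    (hV : ∀ x ≠ 0, ContDiffAt ℝ 1 (radialExt V) x) :
    ∫ p, sphereDiv V p ∂((volume : Measure R4).toSphere) = 0 := by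
  obtain ⟨b, hb, hb0, hb1, hb3, hb2⟩ := exists_contDiff_radial_cutoff
  have hρ : ContDiff ℝ 1 fun r => r * b r := contDiff_id.mul hb
  have hdiv : ∀ᵐ x : R4, LinearMap.trace ℝ R4
      (fderiv ℝ (fun y => (‖y‖ * b ‖y‖) • radialExt V y) x : R4 →ₗ[ℝ] R4) =
        b ‖x‖ * radialExt (sphereDiv V) x := by
    filter_upwards [Measure.ae_ne volume 0] with x hx
    rw [trace_fderiv_radial_smul (hρ.differentiable one_ne_zero) hx
      ((hV x hx).differentiableAt one_ne_zero) (inner_radialExt htangent hx), mul_comm ‖x‖,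
      mul_assoc, norm_mul_trace_fderiv_radialExt V hx]
  have hsmooth : ContDiff ℝ 1 fun y => (‖y‖ * b ‖y‖) • radialExt V y :=
    contDiff_radial_smul hρ (fun r hr => by rw [hb1 r hr, mul_zero]) hV
  have hsupp : HasCompactSupport fun y => (‖y‖ * b ‖y‖) • radialExt V y :=
    hasCompactSupport_radial_smul (ρ := fun r => r * b r)
      (fun r hr => by rw [hb3 r hr, mul_zero]) _
  have hzero := integral_trace_fderiv_eq_zero volume hsmooth hsupp
  rw [integral_congr_ae hdiv, integral_norm_mul_radialExt b] at hzero
  exact (mul_eq_zero.mp hzero).resolve_left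
    (integral_volumeIoiPow_ne_zero hb.continuous hb0 hb3 two_pos hb2)

end SphereDivergence

section Green

variable {f g : S3 → ℝ}

theorem fderiv_radialExt_self {x : R4} (hf : DifferentiableAt ℝ (radialExt f) x) :
    fderiv ℝ (radialExt f) x x = 0 := by
  have hd : HasFDerivAt (radialExt f) (fderiv ℝ (radialExt f) x) ((fun t : ℝ => t • x) 1) := by
    simpa using hf.hasFDerivAt
  have hray := hd.comp_hasDerivAt (1 : ℝ) ((hasDerivAt_id (1 : ℝ)).smul_const x)
  have hconst : HasDerivAt (radialExt f ∘ fun t : ℝ => t • x) 0 1 := by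
    refine (hasDerivAt_const (1 : ℝ) (radialExt f x)).congr_of_eventuallyEq ?_
    filter_upwards [lt_mem_nhds (zero_lt_one (α := ℝ))] with t ht
    exact radialExt_smul_pos f ht x
  simpa using hray.unique hconst

theorem inner_sphereGrad (hf : SmoothOnS3 f) (p : S3) :
    inner ℝ (p : R4) (sphereGrad f p) = 0 := by
  rw [sphereGrad, real_inner_comm, inner_gradient_left, fderiv_radialExt_self
    ((contDiffAt_radialExt hf (ne_zero_S3 p)).differentiableAt (by simp))]

theorem contDiffAt_radialExt_sphereGrad (hf : SmoothOnS3 f) {x : R4} (hx : x ≠ 0) :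
    ContDiffAt ℝ 1 (radialExt (sphereGrad f)) x := by
  have hG : ContDiffAt ℝ 1 (gradient (radialExt f)) x :=
    (InnerProductSpace.toDual ℝ R4).symm.toContinuousLinearEquiv.contDiff.contDiffAt.comp x
      ((contDiffAt_radialExt hf hx).fderiv_right (m := 1) (by norm_cast))
  refine ((contDiffAt_norm ℝ hx).smul hG).congr_of_eventuallyEq ?_
  filter_upwards [isOpen_ne.mem_nhds hx] with y hy
  have hn : 0 < ‖y‖⁻¹ := inv_pos.mpr (norm_pos_iff.mpr hy)
  rw [radialExt_of_ne_zero _ hy, sphereGrad, gradient, fderiv_radialExt_smul f hn]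
  simp [gradient]

theorem radialExt_smul_fun {F : Type*} [AddCommGroup F] [Module ℝ F] (f : S3 → ℝ) (V : S3 → F) :
    radialExt (fun p => f p • V p) = fun x => radialExt f x • radialExt V x := by
  funext x
  by_cases hx : x = 0 <;> simp [radialExt, hx]

theorem contDiffAt_radialExt_smul_sphereGrad (hf : SmoothOnS3 f) (hg : SmoothOnS3 g) {x : R4}
    (hx : x ≠ 0) : ContDiffAt ℝ 1 (radialExt fun p => f p • sphereGrad g p) x := by
  rw [radialExt_smul_fun]
  exact ((contDiffAt_radialExt hf hx).of_le (by norm_cast)).smul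
    (contDiffAt_radialExt_sphereGrad hg hx)

theorem sphereDiv_smul_sphereGrad (hf : SmoothOnS3 f) (hg : SmoothOnS3 g) (p : S3) :
    sphereDiv (fun q => f q • sphereGrad g q) p =
      f p * sphereLaplacian g p + inner ℝ (sphereGrad f p) (sphereGrad g p) := by
  have hp := ne_zero_S3 p
  rw [sphereDiv, radialExt_smul_fun, trace_fderiv_smul
    ((contDiffAt_radialExt hf hp).differentiableAt (by simp))
    ((contDiffAt_radialExt_sphereGrad hg hp).differentiableAt one_ne_zero)]
  have hfp : radialExt f p = f p := by simp [radialExt_of_ne_zero _ hp]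
  have hgp : radialExt (sphereGrad g) p = sphereGrad g p := by simp [radialExt_of_ne_zero _ hp]
  rw [hfp, hgp, sphereGrad.eq_1 f, inner_gradient_left]
  rfl

theorem integral_mul_sphereLaplacian_sub (hf : SmoothOnS3 f) (hg : SmoothOnS3 g) :
    ∫ p, f p * sphereLaplacian g p - g p * sphereLaplacian f p
      ∂((volume : Measure R4).toSphere) = 0 := by
  set V : S3 → R4 := (fun p => f p • sphereGrad g p) + (-1 : ℝ) • fun p => g p • sphereGrad f p
    with hVdef
  have hfg {x : R4} (hx : x ≠ 0) := contDiffAt_radialExt_smul_sphereGrad hf hg hx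
  have hgf {x : R4} (hx : x ≠ 0) := contDiffAt_radialExt_smul_sphereGrad hg hf hx
  have hV : radialExt V = radialExt (fun p => f p • sphereGrad g p) +
      (-1 : ℝ) • radialExt fun p => g p • sphereGrad f p := by
    rw [hVdef, radialExt_add, radialExt_smul]
  have hdiv (p : S3) : sphereDiv V p = f p * sphereLaplacian g p - g p * sphereLaplacian f p := by
    have hp := ne_zero_S3 p
    have hsplit : sphereDiv V p = sphereDiv (fun q => f q • sphereGrad g q) p -
        sphereDiv (fun q => g q • sphereGrad f q) p := by
      rw [sphereDiv, hV, fderiv_add ((hfg hp).differentiableAt one_ne_zero)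
        (((hgf hp).differentiableAt one_ne_zero).const_smul (-1 : ℝ)),
        fderiv_const_smul ((hgf hp).differentiableAt one_ne_zero)]
      simp [sphereDiv, sub_eq_add_neg]
    rw [hsplit, sphereDiv_smul_sphereGrad hf hg, sphereDiv_smul_sphereGrad hg hf, real_inner_comm]
    ring
  simp only [← hdiv]
  refine integral_sphereDiv_eq_zero (fun p => ?_) fun x hx => ?_
  · simp [hVdef, inner_add_right, inner_smul_right, inner_sphereGrad hf, inner_sphereGrad hg]
  · rw [hV]
    exact (hfg hx).add (contDiffAt_const.smul (hgf hx))

theorem sphereInner_eq_zero_of_mem_eigenspace {μ ν : ℝ} (hμν : μ ≠ ν) (hf : f ∈ eigenspace μ)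
    (hg : g ∈ eigenspace ν) : sphereInner f g = 0 := by
  have h := integral_mul_sphereLaplacian_sub hf.1 hg.1
  have heq (p : S3) : f p * sphereLaplacian g p - g p * sphereLaplacian f p =
      (ν - μ) * (f p * g p) := by
    rw [hf.2, hg.2]
    ring
  simp only [heq, integral_const_mul] at h
  exact (mul_eq_zero.mp h).resolve_left (sub_ne_zero.mpr hμν.symm)

end Green

section GaussianIntegrals

open MvPolynomial

theorem integral_euclideanSpace_fin_four_mul (u v : ℝ × ℝ → ℝ) :
    ∫ x : R4, u (x 0, x 1) * v (x 2, x 3) = (∫ a, u a) * ∫ b, v b := by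
  let e := (MeasurableEquiv.piCongrLeft (fun _ : Fin 4 => ℝ)
    (finSumFinEquiv (m := 2) (n := 2))).symm
  have he : MeasurePreserving e volume volume :=
    (volume_measurePreserving_piCongrLeft (fun _ : Fin 4 => ℝ)
      (finSumFinEquiv (m := 2) (n := 2))).symm
  let s := MeasurableEquiv.sumPiEquivProdPi (fun _ : Fin 2 ⊕ Fin 2 => ℝ)
  have hs : MeasurePreserving s volume volume := volume_measurePreserving_sumPiEquivProdPi _
  have ht := volume_preserving_finTwoArrow ℝ
  have hmp := (((ht.prod ht).comp hs).comp he).comp (PiLp.volume_preserving_ofLp (Fin 4))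
  have hemb : MeasurableEmbedding (Prod.map (MeasurableEquiv.finTwoArrow (α := ℝ))
      (MeasurableEquiv.finTwoArrow (α := ℝ))) :=
    (MeasurableEquiv.prodCongr MeasurableEquiv.finTwoArrow
      MeasurableEquiv.finTwoArrow).measurableEmbedding
  have h := hmp.integral_comp (((hemb.comp s.measurableEmbedding).comp
    e.measurableEmbedding).comp (MeasurableEquiv.toLp 2 (Fin 4 → ℝ)).symm.measurableEmbedding)
    fun y => u y.1 * v y.2
  rw [integral_prod_mul] at h
  exact h

theorem integral_pow_mul_exp_neg_sq (n : ℕ) :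
    ∫ r in Set.Ioi (0 : ℝ), r ^ n * Real.exp (-r ^ 2) = 1 / 2 * Real.Gamma ((n + 1) / 2) := by
  have h := integral_rpow_mul_exp_neg_rpow (p := 2) (q := n) two_pos
    (by linarith [(Nat.cast_nonneg n : (0 : ℝ) ≤ n)])
  simpa using h

theorem integral_volumeIoiPow_pow_mul_exp_neg_sq (d n : ℕ) :
    ∫ r : Set.Ioi (0 : ℝ), (r : ℝ) ^ n * Real.exp (-(r : ℝ) ^ 2) ∂(Measure.volumeIoiPow d) =
      1 / 2 * Real.Gamma ((n + d + 1) / 2) := by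
  simp only [Measure.volumeIoiPow, ENNReal.ofReal]
  rw [integral_withDensity_eq_integral_smul (measurable_subtype_coe.pow_const _).real_toNNReal,
    integral_subtype_comap measurableSet_Ioi
      fun r : ℝ => Real.toNNReal (r ^ d) • (r ^ n * Real.exp (-r ^ 2)),
    ← Nat.cast_add, ← integral_pow_mul_exp_neg_sq]
  refine setIntegral_congr_fun measurableSet_Ioi fun r hr => ?_
  simp only [NNReal.smul_def, Real.coe_toNNReal _ (pow_nonneg (le_of_lt hr) _), smul_eq_mul]
  ring

theorem eval_smul_of_isHomogeneous {σ : Type*} {f : MvPolynomial σ ℝ} {n : ℕ}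
    (hf : f.IsHomogeneous n) (r : ℝ) (v : σ → ℝ) : eval (r • v) f = r ^ n * eval v f := by
  rw [eval_eq, eval_eq, Finset.mul_sum]
  refine Finset.sum_congr rfl fun d hd => ?_
  have hdeg : ∑ i ∈ d.support, d i = n := (hf.degree_eq_sum_deg_support hd).symm
  simp only [Pi.smul_apply, smul_eq_mul, mul_pow, Finset.prod_mul_distrib,
    Finset.prod_pow_eq_pow_sum, hdeg]
  ring

theorem integral_eval_mul_exp_neg {f : MvPolynomial (Fin 2) ℝ} {n : ℕ} (hf : f.IsHomogeneous n) :
    ∫ a : ℝ × ℝ, eval ![a.1, a.2] f * Real.exp (-(a.1 ^ 2 + a.2 ^ 2)) =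
      1 / 2 * Real.Gamma ((n + 2) / 2) *
        ∫ t in (-Real.pi)..Real.pi, eval ![Real.cos t, Real.sin t] f := by
  have hpi : -Real.pi ≤ Real.pi := by linarith [Real.pi_pos]
  have hradial := integral_pow_mul_exp_neg_sq (n + 1)
  rw [Nat.cast_add_one, add_assoc, one_add_one_eq_two] at hradial
  rw [intervalIntegral.integral_of_le hpi, integral_Ioc_eq_integral_Ioo, ← hradial,
    ← setIntegral_prod_mul, ← integral_comp_polarCoord_symm]
  refine setIntegral_congr_fun (measurableSet_Ioi.prod measurableSet_Ioo) fun a _ => ?_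
  have hscale : ![a.1 * Real.cos a.2, a.1 * Real.sin a.2] =
      a.1 • ![Real.cos a.2, Real.sin a.2] := by simp
  have hradius : (a.1 * Real.cos a.2) ^ 2 + (a.1 * Real.sin a.2) ^ 2 = a.1 ^ 2 := by
    linear_combination a.1 ^ 2 * Real.cos_sq_add_sin_sq a.2
  simp only [polarCoord_symm_apply, hradius, hscale, eval_smul_of_isHomogeneous hf, smul_eq_mul]
  ring

theorem restrict_planeMul_apply (f g : MvPolynomial (Fin 2) ℝ) (p : S3) :
    restrict (planeMul f g) p =
      eval ![(p : R4) 0, (p : R4) 1] f * eval ![(p : R4) 2, (p : R4) 3] g := by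
  rw [restrict_apply, planeMul_apply, map_mul, eval_rename, eval_rename]
  congr 3 <;> (ext i; fin_cases i <;> rfl)

/-- Both sides are the integral of `f(x, y) g(z, w) exp(-(x² + y² + z² + w²))` over `ℝ⁴`, in
spherical coordinates and as a product of two plane integrals. -/
theorem integral_restrict_planeMul {f g : MvPolynomial (Fin 2) ℝ} {a b : ℕ}
    (hf : f.IsHomogeneous a) (hg : g.IsHomogeneous b) :
    1 / 2 * Real.Gamma ((a + b + 4) / 2) *
        ∫ p, restrict (planeMul f g) p ∂((volume : Measure R4).toSphere) =
      (1 / 2 * Real.Gamma ((a + 2) / 2) *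
          ∫ t in (-Real.pi)..Real.pi, eval ![Real.cos t, Real.sin t] f) *
        (1 / 2 * Real.Gamma ((b + 2) / 2) *
          ∫ t in (-Real.pi)..Real.pi, eval ![Real.cos t, Real.sin t] g) := by
  have hradial := integral_volumeIoiPow_pow_mul_exp_neg_sq 3 (a + b)
  rw [show ((a + b : ℕ) + (3 : ℕ) + 1 : ℝ) = a + b + 4 by push_cast; ring] at hradial
  rw [← integral_eval_mul_exp_neg hf, ← integral_eval_mul_exp_neg hg,
    ← integral_euclideanSpace_fin_four_mul, ← hradial,
    ← integral_norm_mul_radialExt fun r => r ^ (a + b) * Real.exp (-r ^ 2)]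
  refine integral_congr_ae ?_
  filter_upwards [Measure.ae_ne volume (0 : R4)] with x hx
  have hnorm : ‖x‖ ^ 2 = x 0 ^ 2 + x 1 ^ 2 + (x 2 ^ 2 + x 3 ^ 2) := by
    rw [EuclideanSpace.real_norm_sq_eq, Fin.sum_univ_four]
    ring
  have hscale (i j : Fin 4) : ![(‖x‖⁻¹ • x) i, (‖x‖⁻¹ • x) j] = ‖x‖⁻¹ • ![x i, x j] := by simp
  have := norm_ne_zero_iff.mpr hx
  rw [radialExt_of_ne_zero _ hx, restrict_planeMul_apply, hscale, hscale,
    eval_smul_of_isHomogeneous hf, eval_smul_of_isHomogeneous hg, hnorm, neg_add, Real.exp_add,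
    pow_add, inv_pow, inv_pow]
  field_simp

end GaussianIntegrals

section CircularHarmonics

theorem integral_cos_int_mul_sub (n : ℤ) (c : ℝ) :
    ∫ t in (-Real.pi)..Real.pi, Real.cos (n * t - c) =
      if n = 0 then 2 * Real.pi * Real.cos c else 0 := by
  split_ifs with h
  · simp [h, ← two_mul]
  · have hn : (n : ℝ) ≠ 0 := Int.cast_ne_zero.mpr h
    rw [intervalIntegral.integral_comp_mul_sub _ hn, integral_cos, Real.sin_sub, Real.sin_sub,
      mul_neg, Real.sin_neg, Real.cos_neg, Real.sin_int_mul_pi]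
    simp

/-- The phase of the circular harmonic of index `n`, written as a shifted cosine. -/
def circPhase (n : ℤ) : ℝ := if 0 ≤ n then 0 else Real.pi / 2

theorem circHarmonic_eq_cos (n : ℤ) (t : ℝ) :
    circHarmonic n t = Real.cos (n.natAbs * t - circPhase n) := by
  unfold circHarmonic circPhase
  split_ifs
  · rw [sub_zero]
  · rw [Real.cos_sub_pi_div_two]

theorem integral_circHarmonic_mul (l l' : ℤ) :
    ∫ t in (-Real.pi)..Real.pi, circHarmonic l t * circHarmonic l' t =
      if l = l' then 2 ^ hat l * Real.pi else 0 := by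
  have hprod (t : ℝ) : circHarmonic l t * circHarmonic l' t =
      2⁻¹ * (Real.cos ((l.natAbs - l'.natAbs : ℤ) * t - (circPhase l - circPhase l')) +
        Real.cos ((l.natAbs + l'.natAbs : ℤ) * t - (circPhase l + circPhase l'))) := by
    rw [circHarmonic_eq_cos, circHarmonic_eq_cos, ← mul_right_inj' two_ne_zero, ← mul_assoc,
      Real.two_mul_cos_mul_cos]
    simp only [Int.cast_sub, Int.cast_add, Int.cast_natCast]
    ring_nf
  have hint (n : ℤ) (s : ℝ) :
      IntervalIntegrable (fun t : ℝ => Real.cos (n * t - s)) volume (-Real.pi) Real.pi :=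
    Continuous.intervalIntegrable (by fun_prop) _ _
  simp only [hprod]
  rw [intervalIntegral.integral_const_mul, intervalIntegral.integral_add (hint _ _) (hint _ _),
    integral_cos_int_mul_sub, integral_cos_int_mul_sub]
  rcases eq_or_ne l l' with rfl | hne
  · by_cases hl : l = 0
    · simp [hl, hat, circPhase]
      ring
    · rw [if_pos (sub_self _), if_neg (by omega)]
      simp [hl, hat]
  · have hopposite (h : (l.natAbs - l'.natAbs : ℤ) = 0) :
        Real.cos (circPhase l - circPhase l') = 0 := by
      unfold circPhase
      split_ifs <;> first | omega | simp
    rw [if_neg (show (l.natAbs + l'.natAbs : ℤ) ≠ 0 by omega), if_neg hne]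
    split_ifs with h
    · simp [hopposite h]
    · simp

end CircularHarmonics

section JacobiPolynomials

open Polynomial

theorem sum_antidiagonal_neg_one_pow_mul_choose_mul_choose (b : ℕ) {d e : ℕ} (he : e ≤ d) :
    ∑ p ∈ antidiagonal d, (-1 : ℤ) ^ p.2 * d.choose p.1 * (b + p.1).choose e =
      if e = d then 1 else 0 := by
  have hiter :
      (fwdDiff 1)^[d] (fun n : ℕ => (n.choose e : ℤ)) = fun _ => if e = d then 1 else 0 := by
    obtain ⟨n, rfl⟩ := exists_add_of_le he
    have hconst : (fwdDiff 1)^[e] (fun n : ℕ => (n.choose e : ℤ)) = fun _ => 1 := by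
      simpa using fwdDiff_iter_choose 0 e
    rw [add_comm, Function.iterate_add_apply, hconst]
    cases n with
    | zero => simp
    | succ n =>
      rw [Function.iterate_succ_apply, fwdDiff_const,
        Function.iterate_fixed (fwdDiff_const 1 (0 : ℤ))]
      simp
  rw [← congrFun hiter b, fwdDiff_iter_eq_sum_shift,
    Finset.Nat.sum_antidiagonal_eq_sum_range_succ_mk]
  simp

theorem jacobiCoeff_mul_factorial (a b e i j : ℕ) :
    jacobiCoeff a b i j * ((b + i + e).factorial * (a + j).factorial) =
      (a + (i + j)).factorial * (b + (i + j)).factorial * e.factorial / (i + j).factorial *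
        ((-1) ^ j * (i + j).choose i * (b + e + i).choose e) := by
  rw [jacobiCoeff, show a + (i + j) = i + (a + j) by ring, show b + (i + j) = j + (b + i) by ring,
    show b + e + i = e + (b + i) by ring, add_comm (b + i) e]
  simp only [Nat.cast_add_choose]
  field_simp

theorem sum_jacobiCoeff_mul_factorial (a b : ℕ) {d e : ℕ} (he : e ≤ d) :
    ∑ p ∈ antidiagonal d,
        jacobiCoeff a b p.1 p.2 * ((b + p.1 + e).factorial * (a + p.2).factorial) =
      if e = d then ((a + d).factorial * (b + d).factorial : ℝ) else 0 := by
  have hsum := congrArg (Int.cast (R := ℝ))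
    (sum_antidiagonal_neg_one_pow_mul_choose_mul_choose (b + e) he)
  push_cast at hsum
  calc _ = ∑ p ∈ antidiagonal d, (a + d).factorial * (b + d).factorial * e.factorial /
        d.factorial * ((-1 : ℝ) ^ p.2 * d.choose p.1 * (b + e + p.1).choose e) :=
        Finset.sum_congr rfl fun p hp => by
          rw [← mem_antidiagonal.mp hp, jacobiCoeff_mul_factorial]
    _ = _ := by
      rw [← Finset.mul_sum, hsum]
      split_ifs with h
      · subst h
        field_simp
      · rw [mul_zero]

/-- The Jacobi polynomial `P_d^{(a,b)}(2 s - 1)`, as a polynomial in `s`. -/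
def jacobiPoly (a b d : ℕ) : ℝ[X] :=
  ∑ p ∈ antidiagonal d, jacobiCoeff a b p.1 p.2 • (X ^ p.1 * (1 - X) ^ p.2)

theorem jacobiP_eq_eval_jacobiPoly (a b d : ℕ) (s : ℝ) :
    jacobiP a b d (2 * s - 1) = (jacobiPoly a b d).eval s := by
  rw [jacobiP, jacobiPoly, eval_finsetSum, Finset.mul_sum,
    Finset.Nat.sum_antidiagonal_eq_sum_range_succ_mk]
  refine Finset.sum_congr rfl fun i hi => ?_
  obtain ⟨j, rfl⟩ := exists_add_of_le (Finset.mem_range_succ_iff.mp hi)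
  rw [add_tsub_cancel_left, jacobiCoeff, show 2 * s - 1 + 1 = 2 * s by ring,
    show 2 * s - 1 - 1 = 2 * (-1 * (1 - s)) by ring]
  simp only [mul_pow, pow_add, eval_smul, eval_mul, eval_pow, eval_sub, eval_one, eval_X,
    smul_eq_mul]
  field_simp

theorem natDegree_jacobiPoly_le (a b d : ℕ) : (jacobiPoly a b d).natDegree ≤ d := by
  refine natDegree_sum_le_of_forall_le _ _ fun p hp => (natDegree_smul_le _ _).trans ?_
  have hlinear : (1 - X : ℝ[X]).natDegree ≤ 1 := by compute_degree
  rw [← mem_antidiagonal.mp hp]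
  simpa using natDegree_mul_le_of_le (natDegree_X_pow_le p.1)
    (natDegree_pow_le_of_le p.2 hlinear)

theorem coeff_X_pow_mul_one_sub_X_pow (i j : ℕ) :
    (X ^ i * (1 - X) ^ j : ℝ[X]).coeff (i + j) = (-1) ^ j := by
  have hlinear : (1 - X : ℝ[X]).natDegree ≤ 1 := by compute_degree
  have hcoeff : (1 - X : ℝ[X]).coeff 1 = -1 := by simp [coeff_one]
  rw [add_comm, coeff_X_pow_mul, ← hcoeff, ← coeff_pow_of_natDegree_le hlinear, mul_one]

theorem coeff_jacobiPoly (a b d : ℕ) :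
    (jacobiPoly a b d).coeff d = (a + b + 2 * d).choose d := by
  rw [show a + b + 2 * d = a + d + (b + d) by ring, Nat.add_choose_eq, jacobiPoly, finsetSum_coeff,
    Nat.cast_sum]
  refine Finset.sum_congr rfl fun p hp => ?_
  rw [← mem_antidiagonal.mp hp, coeff_smul, coeff_X_pow_mul_one_sub_X_pow, jacobiCoeff, smul_eq_mul,
    mul_right_comm, ← pow_add, Even.neg_one_pow ⟨_, rfl⟩, one_mul, Nat.cast_mul]

theorem span_range_jacobiPoly (a b : ℕ) : Submodule.span ℝ (Set.range (jacobiPoly a b)) = ⊤ := by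
  have hcoeff (d : ℕ) : (jacobiPoly a b d).coeff d ≠ 0 := by
    rw [coeff_jacobiPoly]
    exact_mod_cast (Nat.choose_pos (by lia)).ne'
  let S : Polynomial.Sequence ℝ :=
    ⟨jacobiPoly a b, fun d => degree_eq_of_le_of_coeff_ne_zero
      (natDegree_le_iff_degree_le.mp (natDegree_jacobiPoly_le a b d)) (hcoeff d)⟩
  exact S.span fun d => (leadingCoeff_ne_zero.mpr (S.ne_zero d)).isUnit

end JacobiPolynomials

section ToroidalCoordinates

open Polynomial

theorem torPoint_coords (p : S3) : torPoint (coordChi p) (coordTheta p) (coordPhi p) = p := by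
  have hsphere : (p : R4) 0 ^ 2 + (p : R4) 1 ^ 2 + ((p : R4) 2 ^ 2 + (p : R4) 3 ^ 2) = 1 := by
    have hnorm := EuclideanSpace.real_norm_sq_eq (p : R4)
    rw [norm_eq_of_mem_sphere, Fin.sum_univ_four] at hnorm
    linarith
  have hnorm (a b : ℝ) : ‖(⟨a, b⟩ : ℂ)‖ = Real.sqrt (a ^ 2 + b ^ 2) := by
    rw [Complex.norm_def, Complex.normSq_apply, pow_two, pow_two]
  have hcos : Real.cos (coordChi p) = Real.sqrt ((p : R4) 0 ^ 2 + (p : R4) 1 ^ 2) := by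
    refine Real.cos_arccos (neg_one_lt_zero.le.trans (Real.sqrt_nonneg _)) ?_
    rw [Real.sqrt_le_one]
    exact (le_add_of_nonneg_right (by positivity)).trans_eq hsphere
  have hsin : Real.sin (coordChi p) = Real.sqrt ((p : R4) 2 ^ 2 + (p : R4) 3 ^ 2) := by
    rw [coordChi, Real.sin_arccos, Real.sq_sqrt (by positivity),
      sub_eq_of_eq_add' hsphere.symm]
  ext i
  fin_cases i <;>
    simp [torPoint, hcos, hsin, coordTheta, coordPhi, ← hnorm, Complex.norm_mul_cos_arg,
      Complex.norm_mul_sin_arg]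

/-- The function on the sphere given in toroidal coordinates by
`cos^|l| χ * sin^|m| χ * q(cos² χ)` times the circular harmonics of indices `l` and `m`. -/
def harmMul (l m : ℤ) : ℝ[X] →ₗ[ℝ] C(S3, ℝ) :=
  LinearMap.mulLeft ℝ (restrict (planeMul (harmPoly l) (harmPoly m))) ∘ₗ
    (aeval (restrict (planeMul normSqPoly 1))).toLinearMap

theorem harmMul_torPoint (l m : ℤ) (q : ℝ[X]) (χ θ φ : ℝ) :
    harmMul l m q (torPoint χ θ φ) = Real.cos χ ^ l.natAbs * circHarmonic l θ *
      (Real.sin χ ^ m.natAbs * circHarmonic m φ) * q.eval (Real.cos χ ^ 2) := by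
  have hradius : Real.cos χ ^ 2 * Real.cos θ ^ 2 + Real.cos χ ^ 2 * Real.sin θ ^ 2 =
      Real.cos χ ^ 2 := by
    rw [← mul_add, Real.cos_sq_add_sin_sq, mul_one]
  have haeval (f : C(S3, ℝ)) (p : S3) : aeval f q p = q.eval (f p) := by
    rw [← ContinuousMap.evalAlgHom_apply (S := ℝ) (R := ℝ), ← aeval_algHom_apply]
    simp [← coe_aeval_eq_eval]
  simp [harmMul, haeval, restrict_planeMul_apply, torPoint, eval_polar_harmPoly,
    normSqPoly_fin_two, mul_pow, hradius]

theorem restrict_planeMul_normSqPoly_pow_mul (l m : ℤ) (i j : ℕ) :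
    restrict (planeMul (normSqPoly ^ i * harmPoly l) (normSqPoly ^ j * harmPoly m)) =
      harmMul l m (X ^ i * (1 - X) ^ j) := by
  have hsum : planeMul 1 normSqPoly = normSqPoly - planeMul normSqPoly 1 := by
    simp [planeMul_apply, normSqPoly, Fin.sum_univ_four]
    ring
  have hone : 1 - restrict (planeMul normSqPoly 1) = restrict (planeMul 1 normSqPoly) := by
    rw [hsum, map_sub, restrict_normSqPoly]
  simp only [harmMul, LinearMap.comp_apply, AlgHom.toLinearMap_apply, LinearMap.mulLeft_apply,
    map_mul, map_pow, map_sub, map_one, aeval_X, hone]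
  simp only [planeMul_apply, map_mul, map_pow, map_one, one_mul, mul_one]
  ring

theorem restrict_modePoly (l m : ℤ) (d : ℕ) :
    restrict (modePoly l m d) = harmMul l m (jacobiPoly m.natAbs l.natAbs d) := by
  simp only [modePoly, jacobiPoly, map_sum, map_smul, restrict_planeMul_normSqPoly_pow_mul]

theorem restrict_modePoly_torPoint (k : ℕ) (l m : ℤ) (χ θ φ : ℝ) :
    restrict (modePoly l m (modeDeg k l m)) (torPoint χ θ φ) = modeTilde k l m χ θ φ := by
  rw [restrict_modePoly, harmMul_torPoint, modeTilde, Real.cos_two_mul, jacobiP_eq_eval_jacobiPoly]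
  ring

theorem mode_eq_smul_restrict (k : ℕ) (l m : ℤ) :
    mode k l m = ⇑((modeNorm k l m)⁻¹ • restrict (modePoly l m (modeDeg k l m))) := by
  funext p
  rw [mode, modeCoord, ← restrict_modePoly_torPoint, torPoint_coords, div_eq_inv_mul,
    ContinuousMap.smul_apply, smul_eq_mul]

theorem mode_torPoint (k : ℕ) (l m : ℤ) (χ θ φ : ℝ) :
    mode k l m (torPoint χ θ φ) = modeCoord k l m χ θ φ := by
  rw [mode_eq_smul_restrict, ContinuousMap.smul_apply, restrict_modePoly_torPoint, modeCoord,
    smul_eq_mul, div_eq_inv_mul]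

end ToroidalCoordinates

section Orthonormality

open Polynomial

/-- A continuous function on the sphere as an element of the Hilbert space of square-integrable
functions, whose inner product is `sphereInner`. -/
def toL2 : C(S3, ℝ) →L[ℝ] Lp ℝ 2 (volume : Measure R4).toSphere :=
  ContinuousMap.toLp 2 _ ℝ

theorem inner_toL2 (f g : C(S3, ℝ)) : inner ℝ (toL2 f) (toL2 g) = sphereInner f g := by
  rw [toL2, ContinuousMap.inner_toLp, sphereInner]
  simp [mul_comm]

theorem integral_eval_circle_mul (l l' : ℤ) (i i' : ℕ) :
    ∫ t in (-Real.pi)..Real.pi, MvPolynomial.eval ![Real.cos t, Real.sin t]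
        (normSqPoly ^ i * harmPoly l * (normSqPoly ^ i' * harmPoly l')) =
      if l = l' then 2 ^ hat l * Real.pi else 0 := by
  have heval (n : ℤ) (t : ℝ) :
      MvPolynomial.eval ![Real.cos t, Real.sin t] (harmPoly n) = circHarmonic n t := by
    simpa using eval_polar_harmPoly n 1 t
  simp [← integral_circHarmonic_mul, heval, normSqPoly_fin_two]

theorem restrict_planeMul_mul_restrict_planeMul (f f' g g' : MvPolynomial (Fin 2) ℝ) :
    restrict (planeMul f g) * restrict (planeMul f' g') =
      restrict (planeMul (f * f') (g * g')) := by
  simp only [planeMul_apply, map_mul]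
  ring

theorem isHomogeneous_mul_normSqPoly_pow_mul_harmPoly (l l' : ℤ) (i i' : ℕ) :
    (normSqPoly ^ i * harmPoly l * (normSqPoly ^ i' * harmPoly l')).IsHomogeneous
      (2 * i + l.natAbs + (2 * i' + l'.natAbs)) :=
  ((isHomogeneous_normSqPoly.pow i).mul (isHomogeneous_harmPoly l)).mul
    ((isHomogeneous_normSqPoly.pow i').mul (isHomogeneous_harmPoly l'))

theorem sphereInner_restrict_planeMul (l m l' m' : ℤ) (i j i' j' : ℕ) :
    sphereInner (restrict (planeMul (normSqPoly ^ i * harmPoly l) (normSqPoly ^ j * harmPoly m)))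
        (restrict (planeMul (normSqPoly ^ i' * harmPoly l') (normSqPoly ^ j' * harmPoly m'))) =
      if l = l' ∧ m = m' then 2 ^ (hat l + hat m) * Real.pi ^ 2 / 2 *
        ((l.natAbs + i + i').factorial * (m.natAbs + j + j').factorial /
          (l.natAbs + m.natAbs + (i + j) + (i' + j') + 1).factorial) else 0 := by
  have h := integral_restrict_planeMul (isHomogeneous_mul_normSqPoly_pow_mul_harmPoly l l' i i')
    (isHomogeneous_mul_normSqPoly_pow_mul_harmPoly m m' j j')
  rw [integral_eval_circle_mul, integral_eval_circle_mul,
    ← restrict_planeMul_mul_restrict_planeMul] at h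
  change _ * sphereInner _ _ = _ at h
  have hgamma (n : ℕ) {x : ℝ} (hx : x = n + 1) : Real.Gamma x = n.factorial := by
    rw [hx, Real.Gamma_nat_eq_factorial]
  rw [← mul_right_inj' (a := 1 / 2 * Real.Gamma _) ?_, h]
  · by_cases hl : l = l'
    · by_cases hm : m = m'
      · subst hl hm
        simp only [and_self, if_true]
        rw [hgamma (l.natAbs + i + i') (by push_cast; ring),
          hgamma (m.natAbs + j + j') (by push_cast; ring),
          hgamma (l.natAbs + m.natAbs + (i + j) + (i' + j') + 1) (by push_cast; ring)]
        field_simp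
        ring
      · simp [hm]
    · simp [hl]
  · exact mul_ne_zero (by norm_num) (Real.Gamma_pos_of_pos (by positivity)).ne'

theorem sphereInner_restrict_modePoly_X_pow (l m : ℤ) {d e : ℕ} (he : e ≤ d) :
    sphereInner (restrict (modePoly l m d)) (harmMul l m (X ^ e)) =
      if e = d then 2 ^ (hat l + hat m) * Real.pi ^ 2 / 2 *
        ((l.natAbs + d).factorial * (m.natAbs + d).factorial /
          (l.natAbs + m.natAbs + 2 * d + 1).factorial) else 0 := by
  have hX : harmMul l m (X ^ e) =
      restrict (planeMul (normSqPoly ^ e * harmPoly l) (normSqPoly ^ 0 * harmPoly m)) := by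
    rw [restrict_planeMul_normSqPoly_pow_mul, pow_zero, mul_one]
  calc sphereInner (restrict (modePoly l m d)) (harmMul l m (X ^ e))
      = ∑ p ∈ antidiagonal d, jacobiCoeff m.natAbs l.natAbs p.1 p.2 *
          (2 ^ (hat l + hat m) * Real.pi ^ 2 / 2 *
            ((l.natAbs + p.1 + e).factorial * (m.natAbs + p.2).factorial /
              (l.natAbs + m.natAbs + d + e + 1).factorial)) := by
        simp only [hX, modePoly, ← inner_toL2, map_sum, map_smul, sum_inner, real_inner_smul_left]
        refine Finset.sum_congr rfl fun p hp => ?_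
        rw [inner_toL2, sphereInner_restrict_planeMul, if_pos ⟨rfl, rfl⟩, mem_antidiagonal.mp hp,
          add_zero, add_zero]
    _ = 2 ^ (hat l + hat m) * Real.pi ^ 2 / 2 / (l.natAbs + m.natAbs + d + e + 1).factorial *
          ∑ p ∈ antidiagonal d, jacobiCoeff m.natAbs l.natAbs p.1 p.2 *
            ((l.natAbs + p.1 + e).factorial * (m.natAbs + p.2).factorial) := by
        rw [Finset.mul_sum]
        exact Finset.sum_congr rfl fun p _ => by ring
    _ = _ := by
        rw [sum_jacobiCoeff_mul_factorial _ _ he]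
        split_ifs with h
        · subst h
          rw [add_assoc _ e e, ← two_mul]
          ring
        · rw [mul_zero]

theorem restrict_modePoly_eq_sum (l m : ℤ) (d : ℕ) :
    restrict (modePoly l m d) = ∑ e ∈ Finset.range (d + 1),
      (jacobiPoly m.natAbs l.natAbs d).coeff e • harmMul l m (X ^ e) := by
  rw [restrict_modePoly]
  conv_lhs => rw [as_sum_range_C_mul_X_pow' (n := d + 1) _
    (Nat.lt_succ_of_le (natDegree_jacobiPoly_le _ _ _))]
  simp only [← smul_eq_C_mul, map_sum, map_smul]

theorem sphereInner_restrict_modePoly_self (l m : ℤ) (d : ℕ) :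
    sphereInner (restrict (modePoly l m d)) (restrict (modePoly l m d)) =
      2 ^ (hat l + hat m) * Real.pi ^ 2 *
        ((l.natAbs + d).factorial * (m.natAbs + d).factorial /
          (2 * ((l.natAbs + m.natAbs + 2 * d : ℕ) + 1) * d.factorial *
            (l.natAbs + m.natAbs + d).factorial)) := by
  calc sphereInner (restrict (modePoly l m d)) (restrict (modePoly l m d))
      = ∑ e ∈ Finset.range (d + 1), (jacobiPoly m.natAbs l.natAbs d).coeff e *
          sphereInner (restrict (modePoly l m d)) (harmMul l m (X ^ e)) := by
        conv_lhs => rw [← inner_toL2]; arg 3; rw [restrict_modePoly_eq_sum]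
        simp only [map_sum, map_smul, inner_sum, real_inner_smul_right, inner_toL2]
    _ = (jacobiPoly m.natAbs l.natAbs d).coeff d * (2 ^ (hat l + hat m) * Real.pi ^ 2 / 2 *
        ((l.natAbs + d).factorial * (m.natAbs + d).factorial /
          (l.natAbs + m.natAbs + 2 * d + 1).factorial)) := by
        rw [Finset.sum_range_succ, sphereInner_restrict_modePoly_X_pow l m le_rfl, if_pos rfl,
          add_eq_right]
        refine Finset.sum_eq_zero fun e he => ?_
        have hlt := Finset.mem_range.mp he
        rw [sphereInner_restrict_modePoly_X_pow l m hlt.le, if_neg hlt.ne, mul_zero]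
    _ = _ := by
        have hdeg : l.natAbs + m.natAbs + 2 * d = d + (l.natAbs + m.natAbs + d) := by ring
        rw [coeff_jacobiPoly, add_comm m.natAbs, hdeg, Nat.cast_add_choose, Nat.factorial_succ]
        push_cast
        field_simp

theorem sphereInner_restrict_modePoly_of_ne {l m l' m' : ℤ} (h : ¬(l = l' ∧ m = m')) (d d' : ℕ) :
    sphereInner (restrict (modePoly l m d)) (restrict (modePoly l' m' d')) = 0 := by
  simp only [modePoly, ← inner_toL2, map_sum, map_smul, sum_inner, inner_sum, real_inner_smul_left,
    real_inner_smul_right]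
  refine Finset.sum_eq_zero fun p _ => Finset.sum_eq_zero fun p' _ => ?_
  rw [inner_toL2, sphereInner_restrict_planeMul, if_neg h, mul_zero, mul_zero]

end Orthonormality

section Completeness

theorem modeNorm_pos (k : ℕ) (l m : ℤ) : 0 < modeNorm k l m := by
  unfold modeNorm
  positivity

theorem modeDeg_spec {k : ℕ} (q : ModeIndex k) :
    q.1.1.natAbs + q.1.2.natAbs + 2 * modeDeg k q.1.1 q.1.2 = k := by
  have hle := q.2.1
  have hdvd := q.2.2.dvd
  simp only [Int.abs_eq_natAbs] at hle
  rw [modeDeg]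
  omega

theorem modeNorm_sq {k : ℕ} (q : ModeIndex k) :
    modeNorm k q.1.1 q.1.2 ^ 2 =
      sphereInner (restrict (modePoly q.1.1 q.1.2 (modeDeg k q.1.1 q.1.2)))
        (restrict (modePoly q.1.1 q.1.2 (modeDeg k q.1.1 q.1.2))) := by
  rw [sphereInner_restrict_modePoly_self, modeDeg_spec q, modeNorm, mul_pow, mul_pow,
    Real.sq_sqrt (by positivity), Real.sq_sqrt (by positivity)]

/-- The modes of all wave numbers, as continuous functions on the sphere. -/
def modeMap (q : (k : ℕ) × ModeIndex k) : C(S3, ℝ) :=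
  (modeNorm q.1 q.2.1.1 q.2.1.2)⁻¹ •
    restrict (modePoly q.2.1.1 q.2.1.2 (modeDeg q.1 q.2.1.1 q.2.1.2))

theorem coe_modeMap (q : (k : ℕ) × ModeIndex k) : ⇑(modeMap q) = mode q.1 q.2.1.1 q.2.1.2 :=
  (mode_eq_smul_restrict _ _ _).symm

theorem modeMap_mem_eigenspace (q : (k : ℕ) × ModeIndex k) :
    ⇑(modeMap q) ∈ eigenspace (-(q.1 * (q.1 + 2))) := by
  refine Submodule.smul_mem _ _ ⟨smoothOnS3_restrict _, ?_⟩
  have hhom := isHomogeneous_modePoly q.2.1.1 q.2.1.2 (modeDeg q.1 q.2.1.1 q.2.1.2)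
  rw [modeDeg_spec] at hhom
  exact sphereLaplacian_restrict hhom (polyLaplacian_modePoly _ _ _)

theorem eigenvalue_injective : Function.Injective fun k : ℕ => (-(k * (k + 2)) : ℝ) := by
  intro k k' h
  have h' : k * (k + 2) = k' * (k' + 2) := by exact_mod_cast neg_injective h
  nlinarith

theorem orthonormal_toL2_modeMap : Orthonormal ℝ fun q => toL2 (modeMap q) := by
  refine ⟨fun q => ?_, fun q q' hne => ?_⟩
  · have hpos := modeNorm_pos q.1 q.2.1.1 q.2.1.2
    change ‖toL2 (modeMap q)‖ = 1
    rw [← pow_eq_one_iff_of_nonneg (norm_nonneg _) two_ne_zero, ← real_inner_self_eq_norm_sq,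
      modeMap, map_smul, real_inner_smul_left, real_inner_smul_right, inner_toL2, ← modeNorm_sq]
    field_simp
  · obtain ⟨k, q⟩ := q
    obtain ⟨k', q'⟩ := q'
    change inner ℝ (toL2 (modeMap ⟨k, q⟩)) (toL2 (modeMap ⟨k', q'⟩)) = 0
    rcases eq_or_ne k k' with rfl | hk
    · have hq : ¬(q.1.1 = q'.1.1 ∧ q.1.2 = q'.1.2) := fun h =>
        hne (congrArg (Sigma.mk k) (Subtype.ext (Prod.ext h.1 h.2)))
      rw [modeMap, modeMap, map_smul, map_smul, real_inner_smul_left,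
        real_inner_smul_right, inner_toL2, sphereInner_restrict_modePoly_of_ne hq, mul_zero,
        mul_zero]
    · rw [inner_toL2]
      exact sphereInner_eq_zero_of_mem_eigenspace (eigenvalue_injective.ne hk)
        (modeMap_mem_eigenspace ⟨k, q⟩) (modeMap_mem_eigenspace ⟨k', q'⟩)

theorem isOrthonormalBasisOf_span {ι : Type*} {v : ι → C(S3, ℝ)}
    (hv : Orthonormal ℝ fun i => toL2 (v i)) :
    IsOrthonormalBasisOf (fun i => ⇑(v i)) (Submodule.span ℝ (Set.range fun i => ⇑(v i))) := by
  refine ⟨fun i => ?_, fun i j hij => ?_, ?_, rfl⟩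
  · rw [← inner_toL2, real_inner_self_eq_norm_sq, hv.1 i, one_pow]
  · rw [← inner_toL2, hv.2 hij]
  · have hindep : LinearIndependent ℝ v := .of_comp toL2.toLinearMap hv.linearIndependent
    exact hindep.map' (ContinuousMap.coeFnLinearMap ℝ)
      (LinearMap.ker_eq_bot.mpr DFunLike.coe_injective)

theorem restrict_modePoly_mem_span_modeMap (l m : ℤ) (d : ℕ) :
    restrict (modePoly l m d) ∈ Submodule.span ℝ (Set.range modeMap) := by
  obtain ⟨k, hk⟩ : ∃ k, k = l.natAbs + m.natAbs + 2 * d := ⟨_, rfl⟩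
  have hdeg : modeDeg k l m = d := by
    rw [modeDeg]
    omega
  have hle : |l| + |m| ≤ (k : ℤ) := by
    rw [Int.abs_eq_natAbs, Int.abs_eq_natAbs]
    omega
  have hmod : l + m ≡ k [ZMOD 2] := Int.modEq_iff_dvd.mpr (by omega)
  rw [← hdeg]
  exact (Submodule.smul_mem_iff _ (inv_ne_zero (modeNorm_pos k l m).ne')).mp
    (Submodule.subset_span ⟨⟨k, (l, m), hle, hmod⟩, rfl⟩)

theorem harmMul_mem_span_modeMap (l m : ℤ) (f : Polynomial ℝ) :
    harmMul l m f ∈ Submodule.span ℝ (Set.range modeMap) := by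
  have hle : Submodule.span ℝ (Set.range (jacobiPoly m.natAbs l.natAbs)) ≤
      (Submodule.span ℝ (Set.range modeMap)).comap (harmMul l m) := by
    refine Submodule.span_le.mpr (Set.range_subset_iff.mpr fun d => ?_)
    rw [SetLike.mem_coe, Submodule.mem_comap, ← restrict_modePoly]
    exact restrict_modePoly_mem_span_modeMap l m d
  exact hle (span_range_jacobiPoly _ _ ▸ Submodule.mem_top)

theorem restrict_mem_span_modeMap (H : MvPolynomial (Fin 4) ℝ) :
    restrict H ∈ Submodule.span ℝ (Set.range modeMap) := by
  have hle : (⊤ : Submodule ℝ (MvPolynomial (Fin 4) ℝ)) ≤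
      (Submodule.span ℝ (Set.range modeMap)).comap restrict.toLinearMap := by
    rw [← map₂_planeMul_top, ← span_normSqPoly_pow_mul_harmPoly, Submodule.map₂_span_span,
      Submodule.span_le]
    rintro _ ⟨_, ⟨⟨i, l⟩, rfl⟩, _, ⟨⟨j, m⟩, rfl⟩, rfl⟩
    change restrict (planeMul _ _) ∈ Submodule.span ℝ (Set.range modeMap)
    rw [restrict_planeMul_normSqPoly_pow_mul]
    exact harmMul_mem_span_modeMap l m _
  exact hle Submodule.mem_top

theorem denseRange_restrict : DenseRange restrict := by
  have hsep : restrict.range.SeparatesPoints := by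
    intro p q hpq
    obtain ⟨i, hi⟩ : ∃ i, (p : R4) i ≠ (q : R4) i := by
      contrapose! hpq
      exact Subtype.ext (PiLp.ext hpq)
    exact ⟨_, ⟨_, ⟨MvPolynomial.X i, rfl⟩, rfl⟩, by simpa [restrict_apply] using hi⟩
  have hdense :=
    ContinuousMap.subalgebra_topologicalClosure_eq_top_of_separatesPoints restrict.range hsep
  rw [DenseRange, dense_iff_closure_eq, ← AlgHom.coe_range, ← Subalgebra.topologicalClosure_coe,
    hdense, Algebra.coe_top]

theorem eq_zero_of_forall_sphereInner_modeMap {f : C(S3, ℝ)}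
    (hf : ∀ q, sphereInner (modeMap q) f = 0) : f = 0 := by
  have hspan {g : C(S3, ℝ)} (hg : g ∈ Submodule.span ℝ (Set.range modeMap)) :
      inner ℝ (toL2 g) (toL2 f) = 0 := by
    induction hg using Submodule.span_induction with
    | mem g hg => obtain ⟨q, rfl⟩ := hg; rw [inner_toL2, hf]
    | zero => rw [map_zero, inner_zero_left]
    | add g h _ _ hg hh => rw [map_add, inner_add_left, hg, hh, add_zero]
    | smul c g _ hg => rw [map_smul, real_inner_smul_left, hg, mul_zero]
  have horth : (fun g => inner ℝ (toL2 g) (toL2 f)) = fun _ => 0 :=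
    denseRange_restrict.equalizer (by fun_prop) continuous_const
      (funext fun H => hspan (restrict_mem_span_modeMap H))
  have hzero : toL2 f = 0 := inner_self_eq_zero.mp (congrFun horth f)
  exact ContinuousMap.toLp_injective _ (hzero.trans (map_zero _).symm)

instance finite_modeIndex (k : ℕ) : Finite (ModeIndex k) := by
  refine Set.Finite.subset ((Set.finite_Icc (-k : ℤ) k).prod (Set.finite_Icc (-k : ℤ) k)) ?_
  rintro ⟨l, m⟩ ⟨hle, -⟩
  have hl := abs_le.mp ((le_add_of_nonneg_right (abs_nonneg m)).trans hle)
  have hm := abs_le.mp ((le_add_of_nonneg_left (abs_nonneg l)).trans hle)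
  exact ⟨hl, hm⟩

theorem eigenspace_eq_span (k : ℕ) : eigenspace (-(k * (k + 2))) =
    Submodule.span ℝ (Set.range fun q : ModeIndex k => ⇑(modeMap ⟨k, q⟩)) := by
  have := Fintype.ofFinite (ModeIndex k)
  have hle : Submodule.span ℝ (Set.range fun q : ModeIndex k => ⇑(modeMap ⟨k, q⟩)) ≤
      eigenspace (-(k * (k + 2))) :=
    Submodule.span_le.mpr (Set.range_subset_iff.mpr fun q => modeMap_mem_eigenspace ⟨k, q⟩)
  refine le_antisymm (fun f hf => ?_) hle
  lift f to C(S3, ℝ) using hf.1.continuous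
  let g := ∑ q : ModeIndex k, sphereInner (modeMap ⟨k, q⟩) f • modeMap ⟨k, q⟩
  have hg : ⇑g ∈ Submodule.span ℝ (Set.range fun q : ModeIndex k => ⇑(modeMap ⟨k, q⟩)) := by
    rw [ContinuousMap.coe_sum]
    exact sum_mem fun q _ => Submodule.smul_mem _ _ (Submodule.subset_span ⟨q, rfl⟩)
  suffices f - g = 0 by rwa [sub_eq_zero.mp this]
  refine eq_zero_of_forall_sphereInner_modeMap fun ⟨k', q⟩ => ?_
  rcases eq_or_ne k' k with rfl | hk
  · have horth := orthonormal_toL2_modeMap.comp (Sigma.mk k') sigma_mk_injective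
    rw [← inner_toL2, map_sub, inner_sub_right, map_sum, sub_eq_zero, inner_toL2]
    simp only [map_smul]
    exact (horth.inner_right_fintype (fun q => sphereInner (modeMap ⟨k', q⟩) f) q).symm
  · exact sphereInner_eq_zero_of_mem_eigenspace (eigenvalue_injective.ne hk)
      (modeMap_mem_eigenspace ⟨k', q⟩) (sub_mem hf (hle hg))

theorem eigenspace_eq_bot {μ : ℝ} (hμ : ∀ k : ℕ, μ ≠ -(k * (k + 2))) : eigenspace μ = ⊥ := by
  refine (Submodule.eq_bot_iff _).mpr fun f hf => ?_
  lift f to C(S3, ℝ) using hf.1.continuous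
  rw [eq_zero_of_forall_sphereInner_modeMap (f := f) fun q =>
    sphereInner_eq_zero_of_mem_eigenspace (hμ q.1).symm (modeMap_mem_eigenspace q) hf]
  rfl

theorem iSup_eigenspace_eq_span :
    ⨆ μ, eigenspace μ = Submodule.span ℝ (Set.range fun q => ⇑(modeMap q)) := by
  refine le_antisymm (iSup_le fun μ => ?_) (Submodule.span_le.mpr (Set.range_subset_iff.mpr
    fun q => Submodule.mem_iSup_of_mem _ (modeMap_mem_eigenspace q)))
  by_cases h : ∃ k : ℕ, μ = -(k * (k + 2))
  · obtain ⟨k, rfl⟩ := h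
    rw [eigenspace_eq_span]
    exact Submodule.span_mono (Set.range_comp_subset_range (Sigma.mk k) fun q => ⇑(modeMap q))
  · exact (eigenspace_eq_bot (not_exists.mp h)).trans_le bot_le

end Completeness

end ToroidalModes

end

open ToroidalModes in
theorem theorem1 :
    -- in toroidal coordinates, the functions `mode k ℓ m` on the sphere are given by the formula
    (∀ (k : ℕ) (q : ModeIndex k) (χ θ φ : ℝ), 0 ≤ χ → χ ≤ Real.pi / 2 →
      mode k q.1.1 q.1.2 (torPoint χ θ φ) = modeCoord k q.1.1 q.1.2 χ θ φ) ∧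
    -- for each wave number they form an orthonormal basis of the eigenspace
    (∀ k : ℕ, IsOrthonormalBasisOf (fun q : ModeIndex k => mode k q.1.1 q.1.2)
      (eigenspace (-((k : ℝ) * ((k : ℝ) + 2))))) ∧
    -- over all wave numbers together, they form an orthonormal basis of the span of all
    -- eigenfunctions of the Laplacian
    IsOrthonormalBasisOf (fun q : (k : ℕ) × ModeIndex k => mode q.1 q.2.1.1 q.2.1.2)
      (⨆ μ : ℝ, eigenspace μ) := by
  refine ⟨fun k q χ θ φ _ _ => mode_torPoint k q.1.1 q.1.2 χ θ φ, fun k => ?_, ?_⟩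
  · have horth := orthonormal_toL2_modeMap.comp (Sigma.mk k) sigma_mk_injective
    simpa only [eigenspace_eq_span, coe_modeMap] using
      isOrthonormalBasisOf_span (v := fun q => modeMap ⟨k, q⟩) horth
  · simpa only [iSup_eigenspace_eq_span, coe_modeMap] using
      isOrthonormalBasisOf_span orthonormal_toL2_modeMap
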